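/- Call a function $f:\mathbb{R}\to\mathbb{C}$ \emph{positive definite} if it is continuous and $\sum_{j,k=1}^n c_j\overline{c_k}\,f(x_j-x_k)\ge 0$ for all $n$, all $x_1,\dots,x_n\in\mathbb{R}$ and all $c_1,\dots,c_n\in\mathbb{C}$. Let $\Omega^+$ be the cone of positive definite functions $f$ on $\mathbb{R}$ with $f\ge 0$ (the \emph{positive positive definite} functions). For $f\in\Omega^+$ let $I(f)=\Omega^+\cap(f-\Omega^+)$, and call $f$ an \emph{extremal ray generator} of $\Omega^+$ if $I(f)=\{tf : 0\le t\le 1\}$. Write $\widehat f(\xi)=\int_{\mathbb{R}} f(x)e^{2i\pi x\xi}\,dx$. Let $\lambda>0$, let $N\ge 1$ be an integer, and let $P$ be a polynomial of degree $4N$ such that $f(x)=P(x)e^{-\pi\lambda x^2}$ belongs to $\Omega^+$. Then there is a (necessarily unique) polynomial $\widetilde P$ such that $\widehat f(\xi)=\widetilde P(\xi)e^{-\pi\xi^2/\lambda}$ for all $\xi\in\mathbb{R}$, and, counting zeros with multiplicity: (1) if $f$ is an extremal ray generator of $\Omega^+$, then $P$ has at least $4$ real zeros or $\widetilde P$ has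 at least $4$ real zeros (possibly both); (2) if $P$ has $4N$ real zeros or $\widetilde P$ has $4N$ real zeros, then $f$ is an extremal ray generator of $\Omega^+$. -/

import Mathlib

open scoped ComplexOrder

noncomputable section

/-- A function `f : ℝ → ℂ` is positive definite if it is continuous and, for all real points
`x₁, …, xₙ` and complex numbers `c₁, …, cₙ`, the sum `∑ cⱼ c̄ₖ f (xⱼ - xₖ)` is a nonnegative
real number (in the order on `ℂ`, `0 ≤ z` means that `z` is real and nonnegative). -/
def IsPositiveDefiniteFun (f : ℝ → ℂ) : Prop :=
  Continuous f ∧ ∀ (n : ℕ) (x : Fin n → ℝ) (c : Fin n → ℂ),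
    0 ≤ ∑ j, ∑ k, c j * (starRingEnd ℂ) (c k) * f (x j - x k)

/-- The cone `Ω⁺` of positive positive definite functions on `ℝ`: the positive definite functions
all of whose values are real and nonnegative. -/
def positivePositiveDefinite : Set (ℝ → ℂ) :=
  {f | IsPositiveDefiniteFun f ∧ ∀ x, 0 ≤ f x}

/-- The interval `I(f) = Ω⁺ ∩ (f - Ω⁺)` generated by `f`. -/
def coneInterval (f : ℝ → ℂ) : Set (ℝ → ℂ) :=
  {g | g ∈ positivePositiveDefinite ∧ f - g ∈ positivePositiveDefinite}

/-- `f` is an extremal ray generator of `Ω⁺` if `I(f) = {t f : 0 ≤ t ≤ 1}`. -/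
def IsExtremalRayGenerator (f : ℝ → ℂ) : Prop :=
  coneInterval f = {g | ∃ t : ℝ, 0 ≤ t ∧ t ≤ 1 ∧ g = fun x => (t : ℂ) * f x}

/-- The Fourier transform `f̂(ξ) = ∫ f(x) e^{2iπxξ} dx`. -/
def fourierTransformPlus (f : ℝ → ℂ) (ξ : ℝ) : ℂ :=
  ∫ x : ℝ, f x * Complex.exp (2 * Complex.I * Real.pi * x * ξ)

open Classical in
/-- The number of real zeros of a nonzero polynomial, counted with multiplicity. -/
def numRealZeros (p : Polynomial ℂ) : ℕ :=
  (p.roots.filter fun z => z.im = 0).card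

end

/-! If `g` lies in `I(f)`, then `0 ≤ g ≤ f`, and, since integrable positive definite functions have
nonnegative transform, also `0 ≤ ĝ ≤ f̂`. This double domination is the setting of Hardy's
uncertainty principle. The Fourier–Laplace transform `G` of `g` is entire. Multiplied by
`exp(πz²/λ)`, it grows at most polynomially on the real and imaginary axes and is `O(poly · exp(π(Re
z)²/λ))` everywhere. Phragmén–Lindelöf in each quadrant then gives polynomial growth, and Liouville
makes the product a polynomial (`exists_fourierTransformPlus_eq_of_mem_coneInterval`).

Sufficiency: `g` is thus a polynomial `R` times the same Gaussian, with `0 ≤ R ≤ P` on the real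
line. If all zeros of `P` are real, `R` vanishes at each to at least the same order, so `P ∣ R`; the
quotient is bounded at infinity, hence constant (`eq_C_mul_of_nonneg_of_le`). The same argument
works for the transforms.

Necessity: `P` is even and nonnegative, so a real zero `a ≠ 0` would give double zeros at `a` and
`-a`. With fewer than four real zeros only a double zero at the origin remains, and `P` dominates
every combination of `x⁴` and `x²` (`exists_norm_eval_quartic_le`). If this also holds for the
transform, take `γ = (x⁴ - κx²) exp(-πλx²)`, with `κ` chosen so that `γ̂` is also such a combination
times a Gaussian. Then `f ± εγ` both lie in the cone for small `ε`, while `γ` changes sign and is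
not a multiple of `f`. -/

/-! ### Moments of Gaussians and the transform on polynomials -/

open MeasureTheory in
theorem integrable_pow_mul_cexp_quadratic {b : ℝ} (hb : 0 < b) (c : ℂ) (k : ℕ) :
    Integrable fun x : ℝ => (x : ℂ) ^ k * Complex.exp (-b * x ^ 2 + c * x) := by
  have h (d : ℂ) : Integrable fun x : ℝ => Complex.exp (-b * x ^ 2 + d * x) := by
    simpa using integrable_cexp_quadratic (b := (b : ℂ)) (by simpa using hb) d 0
  -- Since `|x|^k ≤ k! exp |x|`, the power is absorbed by shifting the linear coefficient `c` by
  -- `±1`.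
  refine Integrable.mono' (((h (c + 1)).norm.add (h (c - 1)).norm).const_mul (k.factorial : ℝ))
    (by fun_prop) (.of_forall fun x => ?_)
  have h1 : |x| ^ k ≤ k.factorial * (Real.exp x + Real.exp (-x)) := by
    have h2 := Real.pow_div_factorial_le_exp |x| (abs_nonneg x) k
    rw [div_le_iff₀ (by positivity)] at h2
    have h3 : Real.exp |x| ≤ Real.exp x + Real.exp (-x) := by
      rcases abs_cases x with ⟨h, -⟩ | ⟨h, -⟩ <;> rw [h] <;>
        linarith [Real.exp_pos x, Real.exp_pos (-x)]
    calc |x| ^ k ≤ Real.exp |x| * k.factorial := h2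
      _ ≤ (Real.exp x + Real.exp (-x)) * k.factorial := by gcongr
      _ = _ := mul_comm _ _
  have h4 : Complex.exp (-b * x ^ 2 + (c + 1) * x) =
      Complex.exp (-b * x ^ 2 + c * x) * Complex.exp x := by
    rw [← Complex.exp_add]; ring_nf
  have h5 : Complex.exp (-b * x ^ 2 + (c - 1) * x) =
      Complex.exp (-b * x ^ 2 + c * x) * Complex.exp ((-x : ℝ) : ℂ) := by
    rw [← Complex.exp_add]; push_cast; ring_nf
  simp only [Pi.add_apply, h4, h5, norm_mul, norm_pow, Complex.norm_real, Complex.norm_exp_ofReal,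
    Real.norm_eq_abs]
  calc |x| ^ k * ‖Complex.exp (-b * x ^ 2 + c * x)‖
      ≤ (k.factorial * (Real.exp x + Real.exp (-x))) * ‖Complex.exp (-b * x ^ 2 + c * x)‖ := by
        gcongr
    _ = _ := by ring

theorem hasDerivAt_pow_succ_mul_cexp_quadratic (b c : ℂ) (k : ℕ) (x : ℝ) :
    HasDerivAt (fun x : ℝ => (x : ℂ) ^ (k + 1) * Complex.exp (-b * x ^ 2 + c * x))
      ((k + 1) * ((x : ℂ) ^ k * Complex.exp (-b * x ^ 2 + c * x))
        + c * ((x : ℂ) ^ (k + 1) * Complex.exp (-b * x ^ 2 + c * x))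
        - 2 * b * ((x : ℂ) ^ (k + 2) * Complex.exp (-b * x ^ 2 + c * x))) x := by
  have hid : HasDerivAt (fun x : ℝ => (x : ℂ)) 1 x := Complex.ofRealCLM.hasDerivAt
  have h1 := ((hid.pow 2).const_mul (-b)).add (hid.const_mul c)
  have h2 := (hid.pow (k + 1)).mul h1.cexp
  convert! h2 using 1
  simp
  ring

theorem hasDerivAt_cexp_quadratic (b c : ℂ) (x : ℝ) :
    HasDerivAt (fun x : ℝ => Complex.exp (-b * x ^ 2 + c * x))
      (c * Complex.exp (-b * x ^ 2 + c * x)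
        - 2 * b * ((x : ℂ) ^ 1 * Complex.exp (-b * x ^ 2 + c * x))) x := by
  have hid : HasDerivAt (fun x : ℝ => (x : ℂ)) 1 x := Complex.ofRealCLM.hasDerivAt
  have h1 := ((hid.pow 2).const_mul (-b)).add (hid.const_mul c)
  convert! h1.cexp using 1
  simp
  ring

/-- The moments of `exp (-b x² + c x)` satisfy a three-term recursion. -/
theorem integral_pow_add_two_mul_cexp_quadratic {b : ℝ} (hb : 0 < b) (c : ℂ) (k : ℕ) :
    2 * b * ∫ x : ℝ, (x : ℂ) ^ (k + 2) * Complex.exp (-b * x ^ 2 + c * x) =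
      (k + 1) * (∫ x : ℝ, (x : ℂ) ^ k * Complex.exp (-b * x ^ 2 + c * x))
        + c * ∫ x : ℝ, (x : ℂ) ^ (k + 1) * Complex.exp (-b * x ^ 2 + c * x) := by
  have hi := integrable_pow_mul_cexp_quadratic hb c
  have := MeasureTheory.integral_eq_zero_of_hasDerivAt_of_integrable
    (hasDerivAt_pow_succ_mul_cexp_quadratic b c k)
    ((((hi k).const_mul _).add ((hi (k + 1)).const_mul _)).sub ((hi (k + 2)).const_mul _))
    (hi (k + 1))
  rw [MeasureTheory.integral_sub ?_ ((hi (k + 2)).const_mul _),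
    MeasureTheory.integral_add ((hi k).const_mul _) ((hi (k + 1)).const_mul _)] at this
  swap
  · exact ((hi k).const_mul _).add ((hi (k + 1)).const_mul _)
  simp only [MeasureTheory.integral_const_mul] at this
  exact (sub_eq_zero.mp this).symm

/-- Base case of the moment recursion, where differentiation produces no lower power of `x`. -/
theorem integral_id_mul_cexp_quadratic {b : ℝ} (hb : 0 < b) (c : ℂ) :
    2 * b * ∫ x : ℝ, (x : ℂ) ^ 1 * Complex.exp (-b * x ^ 2 + c * x) =
      c * ∫ x : ℝ, Complex.exp (-b * x ^ 2 + c * x) := by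
  have hi := integrable_pow_mul_cexp_quadratic hb c
  have h0 : MeasureTheory.Integrable fun x : ℝ => Complex.exp (-b * x ^ 2 + c * x) := by
    simpa using hi 0
  have := MeasureTheory.integral_eq_zero_of_hasDerivAt_of_integrable
    (hasDerivAt_cexp_quadratic b c) ((h0.const_mul _).sub ((hi 1).const_mul _)) h0
  rw [MeasureTheory.integral_sub (h0.const_mul _) ((hi 1).const_mul _)] at this
  simp only [MeasureTheory.integral_const_mul] at this
  exact (sub_eq_zero.mp this).symm

open Polynomial in
/-- The polynomials `H k` with `∫ xᵏ exp (-π lam x² + 2 π i x z) dx = H k (z) exp (-π z² / lam)`. -/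
noncomputable def gaussianMomentPoly (lam : ℝ) : ℕ → ℂ[X]
  | 0 => C (((Real.sqrt lam)⁻¹ : ℝ) : ℂ)
  | 1 => C (Complex.I / (lam : ℂ)) * X * C (((Real.sqrt lam)⁻¹ : ℝ) : ℂ)
  | k + 2 => C (Complex.I / (lam : ℂ)) * X * gaussianMomentPoly lam (k + 1)
      + C (((k : ℂ) + 1) / (2 * (Real.pi : ℂ) * (lam : ℂ))) * gaussianMomentPoly lam k

theorem integral_pow_mul_gaussian {lam : ℝ} (hlam : 0 < lam) (z : ℂ) (k : ℕ) :
    ∫ x : ℝ, (x : ℂ) ^ k * Complex.exp (-(Real.pi * lam : ℝ) * x ^ 2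
        + (2 * Complex.I * Real.pi * z) * x) =
      (gaussianMomentPoly lam k).eval z * Complex.exp (-(Real.pi * z ^ 2 / lam)) := by
  have hb : 0 < Real.pi * lam := by positivity
  have hl : (lam : ℂ) ≠ 0 := by exact_mod_cast hlam.ne'
  have hp : (Real.pi : ℂ) ≠ 0 := by exact_mod_cast Real.pi_ne_zero
  have h0 : ∫ x : ℝ, Complex.exp (-(Real.pi * lam : ℝ) * x ^ 2
      + (2 * Complex.I * Real.pi * z) * x) =
      (gaussianMomentPoly lam 0).eval z * Complex.exp (-(Real.pi * z ^ 2 / lam)) := by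
    have h := integral_cexp_quadratic (b := -((Real.pi * lam : ℝ) : ℂ))
      (by simpa using hb) (2 * Complex.I * Real.pi * z) 0
    simp only [add_zero] at h
    rw [h, gaussianMomentPoly, Polynomial.eval_C]
    congr 1
    · have : (Real.pi : ℂ) / - -((Real.pi * lam : ℝ) : ℂ) = ((lam⁻¹ : ℝ) : ℂ) := by
        push_cast; field_simp
      rw [this, Real.sqrt_eq_rpow, ← Real.inv_rpow hlam.le, Complex.ofReal_cpow (by positivity)]
      norm_num
    · congr 1
      push_cast
      field_simp
      rw [Complex.I_sq]
      ring
  induction k using Nat.twoStepInduction with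
  | zero => simpa using h0
  | one =>
    have h := integral_id_mul_cexp_quadratic hb (2 * Complex.I * Real.pi * z)
    have hne : (2 * ((Real.pi * lam : ℝ) : ℂ)) ≠ 0 := by exact_mod_cast (by positivity)
    apply mul_left_cancel₀ hne
    rw [h, h0]
    simp only [gaussianMomentPoly, Polynomial.eval_C, Polynomial.eval_mul, Polynomial.eval_X]
    push_cast
    field_simp
  | more k ih1 ih2 =>
    have h := integral_pow_add_two_mul_cexp_quadratic hb (2 * Complex.I * Real.pi * z) k
    have hne : (2 * ((Real.pi * lam : ℝ) : ℂ)) ≠ 0 := by exact_mod_cast (by positivity)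
    apply mul_left_cancel₀ hne
    rw [h, ih1, ih2]
    simp only [gaussianMomentPoly, Polynomial.eval_C, Polynomial.eval_mul, Polynomial.eval_X,
      Polynomial.eval_add]
    push_cast
    field_simp
    ring

-- Only the summand with the factor `X` reaches the top degree, so the leading coefficient is
-- `(i/λ)^k / √λ`. Hence the transform preserves degrees.
open Polynomial in
theorem gaussianMomentPoly_natDegree_coeff {lam : ℝ} (hlam : 0 < lam) (k : ℕ) :
    (gaussianMomentPoly lam k).natDegree ≤ k ∧ (gaussianMomentPoly lam k).coeff k ≠ 0 := by
  have hl : (lam : ℂ) ≠ 0 := by exact_mod_cast hlam.ne'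
  have hs : (((Real.sqrt lam)⁻¹ : ℝ) : ℂ) ≠ 0 := by
    exact_mod_cast (by positivity)
  induction k using Nat.twoStepInduction with
  | zero => exact ⟨by simp [gaussianMomentPoly], by simpa [gaussianMomentPoly] using hs⟩
  | one =>
    refine ⟨?_, ?_⟩
    · rw [gaussianMomentPoly]; compute_degree
    · rw [gaussianMomentPoly, coeff_mul_C, coeff_C_mul, coeff_X_one]
      exact mul_ne_zero (by simp [hl]) hs
  | more k ih1 ih2 =>
    refine ⟨?_, ?_⟩
    · rw [gaussianMomentPoly, mul_assoc]
      refine natDegree_add_le_of_degree_le ((natDegree_C_mul_le _ _).trans ?_)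
        ((natDegree_C_mul_le _ _).trans (ih1.1.trans (by omega)))
      refine natDegree_mul_le.trans ?_
      have := ih2.1
      rw [natDegree_X]; omega
    · rw [gaussianMomentPoly, mul_assoc, coeff_add, coeff_C_mul, coeff_C_mul, coeff_X_mul,
        coeff_eq_zero_of_natDegree_lt (p := gaussianMomentPoly lam k) (by have := ih1.1; omega),
        mul_zero, add_zero]
      exact mul_ne_zero (by simp [hl]) ih2.2

open Polynomial in
/-- The polynomial `Q` with `∫ P(x) exp (-π lam x² + 2 π i x z) dx = Q(z) exp (-π z² / lam)`. -/
noncomputable def gaussianTransform (lam : ℝ) (P : ℂ[X]) : ℂ[X] :=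
  ∑ k ∈ Finset.range (P.natDegree + 1), C (P.coeff k) * gaussianMomentPoly lam k

open Polynomial in
theorem natDegree_gaussianTransform {lam : ℝ} (hlam : 0 < lam) (P : ℂ[X]) :
    (gaussianTransform lam P).natDegree = P.natDegree := by
  by_cases hP : P = 0
  · simp [gaussianTransform, hP]
  have hle : ∀ k ∈ Finset.range (P.natDegree + 1),
      (C (P.coeff k) * gaussianMomentPoly lam k).natDegree ≤ k := fun k _ =>
    (natDegree_C_mul_le _ _).trans (gaussianMomentPoly_natDegree_coeff hlam k).1
  refine natDegree_eq_of_le_of_coeff_ne_zero ?_ ?_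
  · refine natDegree_sum_le_of_forall_le _ _ fun k hk => (hle k hk).trans ?_
    rw [Finset.mem_range] at hk; omega
  · rw [gaussianTransform, Finset.sum_range_succ, coeff_add, finsetSum_coeff,
      Finset.sum_eq_zero, zero_add, coeff_C_mul]
    · exact mul_ne_zero (by simpa using hP) (gaussianMomentPoly_natDegree_coeff hlam _).2
    · intro k hk
      refine coeff_eq_zero_of_natDegree_lt ((hle k ?_).trans_lt (Finset.mem_range.mp hk))
      rw [Finset.mem_range] at hk ⊢; omega

theorem eval_mul_gaussian_eq_sum (lam : ℝ) (P : Polynomial ℂ) (x : ℝ) (z : ℂ) :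
    P.eval (x : ℂ) * (Real.exp (-(Real.pi * lam * x ^ 2)) : ℂ)
        * Complex.exp (2 * Complex.I * Real.pi * x * z) =
      ∑ k ∈ Finset.range (P.natDegree + 1), P.coeff k * ((x : ℂ) ^ k *
        Complex.exp (-(Real.pi * lam : ℝ) * x ^ 2 + (2 * Complex.I * Real.pi * z) * x)) := by
  rw [Polynomial.eval_eq_sum_range, mul_assoc, Finset.sum_mul, Complex.ofReal_exp,
    ← Complex.exp_add]
  refine Finset.sum_congr rfl fun k _ => ?_
  push_cast
  ring_nf

theorem integrable_eval_mul_gaussian {lam : ℝ} (hlam : 0 < lam) (P : Polynomial ℂ) (z : ℂ) :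
    MeasureTheory.Integrable fun x : ℝ =>
      P.eval (x : ℂ) * (Real.exp (-(Real.pi * lam * x ^ 2)) : ℂ)
        * Complex.exp (2 * Complex.I * Real.pi * x * z) := by
  simp only [eval_mul_gaussian_eq_sum]
  exact MeasureTheory.integrable_finsetSum _ fun k _ =>
    (integrable_pow_mul_cexp_quadratic (by positivity) _ k).const_mul _

theorem integral_eval_mul_gaussian {lam : ℝ} (hlam : 0 < lam) (P : Polynomial ℂ) (z : ℂ) :
    ∫ x : ℝ, P.eval (x : ℂ) * (Real.exp (-(Real.pi * lam * x ^ 2)) : ℂ)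
        * Complex.exp (2 * Complex.I * Real.pi * x * z) =
      (gaussianTransform lam P).eval z * Complex.exp (-(Real.pi * z ^ 2 / lam)) := by
  simp only [eval_mul_gaussian_eq_sum]
  rw [MeasureTheory.integral_finsetSum _ fun k _ =>
    (integrable_pow_mul_cexp_quadratic (by positivity) _ k).const_mul _, gaussianTransform,
    Polynomial.eval_finsetSum, Finset.sum_mul]
  refine Finset.sum_congr rfl fun k _ => ?_
  rw [MeasureTheory.integral_const_mul, integral_pow_mul_gaussian hlam, Polynomial.eval_mul,
    Polynomial.eval_C, mul_assoc]

/-! ### Fourier inversion and Bochner's theorem for integrable functions -/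

/-- The kernel carries the sign `+2iπxξ`, which is the inverse transform in the usual convention. -/
theorem fourierTransformPlus_eq_fourierInv (f : ℝ → ℂ) :
    fourierTransformPlus f = FourierTransformInv.fourierInv f := by
  ext ξ
  rw [Real.fourierInv_eq', fourierTransformPlus]
  refine MeasureTheory.integral_congr_ae (.of_forall fun x => ?_)
  simp only [smul_eq_mul, RCLike.inner_apply, conj_trivial]
  rw [mul_comm]
  congr 2
  push_cast
  ring

theorem integrable_mul_cexp_ofReal {h : ℝ → ℂ} (hi : MeasureTheory.Integrable h) (ξ : ℝ) :
    MeasureTheory.Integrable fun x : ℝ => h x * Complex.exp (2 * Complex.I * Real.pi * x * ξ) := by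
  refine hi.mul_bdd (c := 1) (by fun_prop) (.of_forall fun x => ?_)
  have : 2 * Complex.I * Real.pi * x * ξ = ((2 * Real.pi * x * ξ : ℝ) : ℂ) * Complex.I := by
    push_cast; ring
  rw [this, Complex.norm_exp_ofReal_mul_I]

/-- Fourier inversion for `fourierTransformPlus`. -/
theorem eq_integral_fourierTransformPlus {h : ℝ → ℂ} (hc : Continuous h)
    (hi : MeasureTheory.Integrable h) (hi' : MeasureTheory.Integrable (fourierTransformPlus h))
    (x : ℝ) : h x = ∫ ξ : ℝ, fourierTransformPlus h ξ *
      Complex.exp (2 * Complex.I * Real.pi * ξ * (-x : ℝ)) := by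
  have h1 : FourierTransform.fourier (FourierTransformInv.fourierInv h) = h := by
    refine hc.fourier_fourierInv_eq hi ?_
    have : FourierTransform.fourier h = fun ξ => fourierTransformPlus h (-ξ) := by
      ext ξ
      rw [fourierTransformPlus_eq_fourierInv, Real.fourierInv_eq_fourier_neg, neg_neg]
    rw [this]
    exact hi'.comp_neg
  conv_lhs => rw [← h1, ← fourierTransformPlus_eq_fourierInv, Real.fourier_eq']
  refine MeasureTheory.integral_congr_ae (.of_forall fun x => ?_)
  simp only [smul_eq_mul, RCLike.inner_apply, conj_trivial]
  rw [mul_comm]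
  congr 2
  push_cast
  ring

/-- A continuous integrable function with nonnegative integrable Fourier transform is positive
definite. -/
theorem isPositiveDefiniteFun_of_fourierTransformPlus_nonneg {h : ℝ → ℂ} (hc : Continuous h)
    (hi : MeasureTheory.Integrable h) (hi' : MeasureTheory.Integrable (fourierTransformPlus h))
    (hn : ∀ ξ, 0 ≤ fourierTransformPlus h ξ) : IsPositiveDefiniteFun h := by
  refine ⟨hc, fun n x c => ?_⟩
  set e : ℝ → ℝ → ℂ := fun y ξ => Complex.exp (2 * Complex.I * Real.pi * ξ * (-y : ℝ)) with he
  have hee (y z ξ : ℝ) : e (y - z) ξ = e y ξ * (starRingEnd ℂ) (e z ξ) := by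
    simp only [he]
    rw [← Complex.exp_conj, ← Complex.exp_add]
    congr 1
    simp only [map_mul, Complex.conj_I, Complex.conj_ofReal, map_ofNat]
    push_cast
    ring
  have hint (j k : Fin n) : MeasureTheory.Integrable fun ξ : ℝ =>
      c j * (starRingEnd ℂ) (c k) * (fourierTransformPlus h ξ * e (x j - x k) ξ) :=
    (integrable_mul_cexp_ofReal hi' _).const_mul _
  -- By inversion, the quadratic form is the integral of the transform against a squared modulus.
  have key : ∑ j, ∑ k, c j * (starRingEnd ℂ) (c k) * h (x j - x k) =
      ∫ ξ : ℝ, fourierTransformPlus h ξ *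
        ((∑ j, c j * e (x j) ξ) * (starRingEnd ℂ) (∑ j, c j * e (x j) ξ)) := by
    calc _ = ∑ j, ∑ k, ∫ ξ : ℝ,
          c j * (starRingEnd ℂ) (c k) * (fourierTransformPlus h ξ * e (x j - x k) ξ) := by
          refine Finset.sum_congr rfl fun j _ => Finset.sum_congr rfl fun k _ => ?_
          rw [MeasureTheory.integral_const_mul, eq_integral_fourierTransformPlus hc hi hi']
      _ = ∫ ξ : ℝ, ∑ j, ∑ k,
          c j * (starRingEnd ℂ) (c k) * (fourierTransformPlus h ξ * e (x j - x k) ξ) := by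
          rw [MeasureTheory.integral_finsetSum _ fun j _ =>
            MeasureTheory.integrable_finsetSum _ fun k _ => hint j k]
          exact Finset.sum_congr rfl fun j _ =>
            (MeasureTheory.integral_finsetSum _ fun k _ => hint j k).symm
      _ = _ := by
          refine MeasureTheory.integral_congr_ae (.of_forall fun ξ => ?_)
          simp only [map_sum, Finset.sum_mul_sum, map_mul, hee]
          simp only [Finset.mul_sum]
          refine Finset.sum_congr rfl fun j _ => Finset.sum_congr rfl fun k _ => ?_
          ring
  rw [key]
  refine MeasureTheory.integral_nonneg fun ξ => mul_nonneg (hn ξ) ?_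
  rw [Complex.mul_conj]
  exact Complex.zero_le_real.mpr (Complex.normSq_nonneg _)

/-- The points `x, 0` with weights `1, -1` give `h x + h (-x) ≤ 2 h 0`, and `h (-x) ≥ 0` can be
dropped. Only boundedness matters later, not the constant. -/
theorem positivePositiveDefinite.norm_le {h : ℝ → ℂ} (hh : h ∈ positivePositiveDefinite) (x : ℝ) :
    ‖h x‖ ≤ 2 * (h 0).re := by
  have h1 := hh.1.2 2 ![x, 0] ![1, -1]
  simp only [Fin.sum_univ_two, Matrix.cons_val_zero, Matrix.cons_val_one, map_one, map_neg,
    sub_self, sub_zero, zero_sub, one_mul, mul_one, mul_neg, neg_mul, neg_neg] at h1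
  have h2 := (Complex.nonneg_iff.mp h1).1
  have h3 := (Complex.nonneg_iff.mp (hh.2 (-x))).1
  have h4 : ‖h x‖ = (h x).re := congrArg Complex.re (RCLike.norm_of_nonneg' (hh.2 x))
  rw [h4]
  simp at h2
  linarith

/-- With weights `1, i` and real values of `h`, the imaginary part of the form is `h (-x) - h x`,
which must vanish. -/
theorem positivePositiveDefinite.even {h : ℝ → ℂ} (hh : h ∈ positivePositiveDefinite) (x : ℝ) :
    h (-x) = h x := by
  have h1 := hh.1.2 2 ![x, 0] ![1, Complex.I]
  simp only [Fin.sum_univ_two, Matrix.cons_val_zero, Matrix.cons_val_one, map_one,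
    sub_self, sub_zero, zero_sub, one_mul, mul_one] at h1
  have h2 := (Complex.nonneg_iff.mp h1).2
  have h3 := (Complex.nonneg_iff.mp (hh.2 (-x))).2
  have h4 := (Complex.nonneg_iff.mp (hh.2 x)).2
  have h5 := (Complex.nonneg_iff.mp (hh.2 0)).2
  simp [← h5] at h2
  exact Complex.ext (by linarith) (by rw [← h3, ← h4])

open MeasureTheory ProbabilityTheory in
theorem map_sub_pi_gaussianReal (v : NNReal) {n : ℕ} {j k : Fin n} (hjk : j ≠ k) :
    (Measure.pi fun _ : Fin n => gaussianReal 0 v).map (fun x => x j - x k) =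
      gaussianReal 0 (v + v) := by
  set P := Measure.pi fun _ : Fin n => gaussianReal 0 v
  have hl (i : Fin n) : P.map (fun x => x i) = gaussianReal 0 v :=
    (measurePreserving_eval (fun _ : Fin n => gaussianReal 0 v) i).map_eq
  have hn : HasLaw (-fun x : Fin n → ℝ => x k) (gaussianReal (-0) v) P :=
    gaussianReal_neg ⟨(measurable_pi_apply k).aemeasurable, hl k⟩
  have hind : IndepFun (fun x : Fin n → ℝ => x j) (-fun x : Fin n → ℝ => x k) P :=
    ((iIndepFun_pi (X := fun (_ : Fin n) (y : ℝ) => y)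
      fun _ => aemeasurable_id).indepFun hjk).comp measurable_id measurable_neg
  have := gaussianReal_add_gaussianReal_of_indepFun hind (hl j) hn.map_eq
  have he : (fun x : Fin n → ℝ => x j - x k) = (fun x => x j) + -fun x => x k := by
    ext x; simp [sub_eq_add_neg]
  rw [he, this]
  simp

open MeasureTheory ProbabilityTheory in
/-- Averaging the positive definiteness inequality over independent Gaussian points. -/
theorem integral_gaussianReal_mul_cexp_nonneg {h : ℝ → ℂ} (hh : h ∈ positivePositiveDefinite)
    (ξ : ℝ) (v : NNReal) :
    0 ≤ ∫ x, h x * Complex.exp (2 * Complex.I * Real.pi * x * ξ) ∂(gaussianReal 0 (v + v)) := by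
  set φ : ℝ → ℂ := fun x => h x * Complex.exp (2 * Complex.I * Real.pi * x * ξ) with hφ
  have hφc : Continuous φ := by have := hh.1.1; fun_prop
  have hφb (x : ℝ) : ‖φ x‖ ≤ 2 * (h 0).re := by
    have : 2 * Complex.I * Real.pi * x * ξ = ((2 * Real.pi * x * ξ : ℝ) : ℂ) * Complex.I := by
      push_cast; ring
    rw [hφ]
    simp only [norm_mul]
    rw [this, Complex.norm_exp_ofReal_mul_I, mul_one]
    exact positivePositiveDefinite.norm_le hh x
  have hφ0 : φ 0 = h 0 := by simp [hφ]
  set I := ∫ x, φ x ∂(gaussianReal 0 (v + v)) with hI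
  -- Take `n` independent `N(0,v)` points with weights `exp(2iπ xⱼ ξ)`. The `n` diagonal terms
  -- average to `h 0`, and the `n(n-1)` others to `I`, as differences are `N(0,2v)`. Large `n`
  -- forces `Re I ≥ 0`; `n = 2` gives `Im I = 0`.
  have main (n : ℕ) : 0 ≤ (n : ℂ) * (h 0 + ((n : ℂ) - 1) * I) := by
    set P := Measure.pi fun _ : Fin n => gaussianReal 0 v
    have hint (j k : Fin n) : Integrable (fun x : Fin n → ℝ => φ (x j - x k)) P :=
      Integrable.of_bound (Continuous.aestronglyMeasurable (by fun_prop)) _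
        (.of_forall fun x => hφb _)
    have h1 : 0 ≤ ∫ x, ∑ j, ∑ k, φ (x j - x k) ∂P := by
      refine integral_nonneg fun x => ?_
      have := hh.1.2 n x fun j => Complex.exp (2 * Complex.I * Real.pi * x j * ξ)
      refine this.trans_eq (Finset.sum_congr rfl fun j _ => Finset.sum_congr rfl fun k _ => ?_)
      rw [← Complex.exp_conj, ← Complex.exp_add, mul_comm, hφ]
      congr 2
      simp only [map_mul, Complex.conj_I, Complex.conj_ofReal, map_ofNat]
      push_cast
      ring
    have hval (j k : Fin n) : ∫ x, φ (x j - x k) ∂P = if j = k then h 0 else I := by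
      split_ifs with hjk
      · simp [hjk, hφ0]
      · rw [hI, ← map_sub_pi_gaussianReal v hjk, integral_map (by fun_prop)
          hφc.aestronglyMeasurable]
    rw [integral_finsetSum _ fun j _ => integrable_finsetSum _ fun k _ => hint j k] at h1
    have h2 (j : Fin n) : ∫ x, ∑ k, φ (x j - x k) ∂P = h 0 + ((n : ℂ) - 1) * I := by
      rw [integral_finsetSum _ fun k _ => hint j k]
      simp only [hval]
      have : ∀ k, (if j = k then h 0 else I) = (if j = k then h 0 - I else 0) + I := by
        intro k; split_ifs <;> simp
      simp only [this, Finset.sum_add_distrib, Finset.sum_ite_eq, Finset.mem_univ, if_true,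
        Finset.sum_const, Finset.card_univ, Fintype.card_fin, nsmul_eq_mul]
      ring
    simpa only [h2, Finset.sum_const, Finset.card_univ, Fintype.card_fin, nsmul_eq_mul] using h1
  have h0 := Complex.nonneg_iff.mp (hh.2 0)
  refine Complex.nonneg_iff.mpr ⟨?_, ?_⟩
  · by_contra! hneg
    obtain ⟨n, hn⟩ := exists_nat_gt ((h 0).re / -I.re)
    rw [div_lt_iff₀ (by linarith)] at hn
    have := (Complex.nonneg_iff.mp (main (n + 1))).1
    simp at this
    have hpos : (0 : ℝ) < n + 1 := by positivity
    nlinarith [nonneg_of_mul_nonneg_right this hpos]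
  · have := (Complex.nonneg_iff.mp (main 2)).2
    norm_num [← h0.2] at this
    exact this.symm

open MeasureTheory ProbabilityTheory in
/-- The Fourier transform of an integrable positive positive definite function is nonnegative. -/
theorem fourierTransformPlus_nonneg {h : ℝ → ℂ} (hh : h ∈ positivePositiveDefinite)
    (hi : Integrable h) (ξ : ℝ) : 0 ≤ fourierTransformPlus h ξ := by
  set φ : ℝ → ℂ := fun x => h x * Complex.exp (2 * Complex.I * Real.pi * x * ξ) with hφ
  have hφi : Integrable φ := integrable_mul_cexp_ofReal hi ξ
  have hn (n : ℕ) : 0 ≤ ∫ x : ℝ, (Real.exp (-x ^ 2 * ((n : ℝ) + 1)⁻¹) : ℂ) * φ x := by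
    -- With this `v`, the `N(0,2v)` density is a multiple of `exp(-x²/(n+1))`, which tends to `1`;
    -- dominated convergence then recovers the transform.
    set v : NNReal := ((n : NNReal) + 1) / 4
    have h1 := integral_gaussianReal_mul_cexp_nonneg hh ξ v
    have hv : v + v ≠ 0 := by positivity
    have hv2 : 2 * ((v + v : NNReal) : ℝ) = (n : ℝ) + 1 := by
      simp [v]; ring
    rw [integral_gaussianReal_eq_integral_smul hv] at h1
    have hc : (0 : ℝ) < (Real.sqrt (2 * Real.pi * (v + v : NNReal)))⁻¹ := by positivity
    have h2 : ∫ x : ℝ, gaussianPDFReal 0 (v + v) x • (h x *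
        Complex.exp (2 * Complex.I * Real.pi * x * ξ)) =
        (((Real.sqrt (2 * Real.pi * (v + v : NNReal)))⁻¹ : ℝ) : ℂ) *
        ∫ x : ℝ, (Real.exp (-x ^ 2 * ((n : ℝ) + 1)⁻¹) : ℂ) * φ x := by
      rw [← integral_const_mul]
      refine integral_congr_ae (.of_forall fun x => ?_)
      simp only [gaussianPDFReal, sub_zero, hv2, Complex.real_smul, Complex.ofReal_mul, hφ,
        div_eq_mul_inv, mul_assoc]
    rw [h2] at h1
    have h3 := mul_nonneg (Complex.zero_le_real.mpr (inv_nonneg.mpr hc.le)) h1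
    rwa [← mul_assoc, ← Complex.ofReal_mul, inv_mul_cancel₀ hc.ne', Complex.ofReal_one,
      one_mul] at h3
  refine ge_of_tendsto' (f := fun n : ℕ => ∫ x : ℝ,
    (Real.exp (-x ^ 2 * ((n : ℝ) + 1)⁻¹) : ℂ) * φ x) (x := Filter.atTop) ?_ hn
  refine tendsto_integral_of_dominated_convergence (fun x => ‖φ x‖) (fun n => ?_) hφi.norm
    (fun n => .of_forall fun x => ?_) (.of_forall fun x => ?_)
  · exact AEStronglyMeasurable.mul (Continuous.aestronglyMeasurable (by fun_prop)) hφi.1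
  · rw [norm_mul]
    refine mul_le_of_le_one_left (norm_nonneg _) ?_
    rw [Complex.norm_real, Real.norm_eq_abs, abs_of_pos (Real.exp_pos _), Real.exp_le_one_iff]
    have : 0 ≤ x ^ 2 * ((n : ℝ) + 1)⁻¹ := by positivity
    linarith
  · have h1 : Filter.Tendsto (fun n : ℕ => -x ^ 2 * ((n : ℝ) + 1)⁻¹) Filter.atTop (nhds 0) := by
      have := (tendsto_one_div_add_atTop_nhds_zero_nat (𝕜 := ℝ)).const_mul (-x ^ 2)
      simpa using this
    have h2 := (Complex.continuous_ofReal.tendsto _).comp ((Real.continuous_exp.tendsto _).comp h1)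
    simpa [Function.comp_def] using h2.mul_const (φ x)

/-! ### Phragmén–Lindelöf and Liouville with polynomial growth -/

/-- Phragmén–Lindelöf in the sector `0 ≤ arg z ≤ θ`, `θ < π / 2`, for functions of order two. -/
theorem norm_le_of_sector {E : ℂ → ℂ} {a K θ : ℝ} (ha : 0 ≤ a) (hθ0 : 0 < θ)
    (hθ : θ < Real.pi / 2) (hE : ∀ z : ℂ, z ≠ 0 → 0 ≤ z.re → DifferentiableAt ℂ E z)
    (hb : ∀ z : ℂ, 0 ≤ z.re → ‖E z‖ ≤ K * Real.exp (a * z.re ^ 2))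
    (hr : ∀ x : ℝ, 0 ≤ x → ‖E x‖ ≤ K) (w : ℂ) (hw0 : 0 ≤ w.im) (hw : w.im ≤ θ) :
    ‖E (Complex.exp w)‖ ≤
      K * Real.exp (a * Real.cos θ / (2 * Real.sin θ) * ‖Complex.exp w‖ ^ 2) := by
  have hsin : 0 < Real.sin θ := Real.sin_pos_of_pos_of_lt_pi hθ0 (by linarith [Real.pi_pos])
  have hcos : 0 < Real.cos θ := Real.cos_pos_of_mem_Ioo ⟨by linarith, hθ⟩
  -- The factor `exp(icz²)` has modulus `1` on the real axis, and this `c` makes it cancel `exp(a(Re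
  -- z)²)` exactly on the ray `arg z = θ`.
  set c : ℝ := a * Real.cos θ / (2 * Real.sin θ) with hc
  have hc0 : 0 ≤ c := by positivity
  have hK : 0 ≤ K := (norm_nonneg _).trans (hr 0 le_rfl)
  set g : ℂ → ℂ := fun z => E z * Complex.exp (Complex.I * c * z ^ 2) with hg
  have hgn (z : ℂ) : ‖g z‖ = ‖E z‖ * Real.exp (-(2 * c * (z.re * z.im))) := by
    rw [hg, norm_mul, Complex.norm_exp]
    congr 2
    simp [pow_two]
    ring
  have hre (v : ℂ) (h0 : 0 ≤ v.im) (h1 : v.im ≤ θ) : 0 ≤ (Complex.exp v).re := by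
    rw [Complex.exp_re]
    exact mul_nonneg (Real.exp_pos _).le (Real.cos_nonneg_of_mem_Icc ⟨by linarith, by linarith⟩)
  have hd (v : ℂ) (h0 : 0 ≤ v.im) (h1 : v.im ≤ θ) :
      DifferentiableAt ℂ (fun v => g (Complex.exp v)) v := by
    have h2 : DifferentiableAt ℂ g (Complex.exp v) :=
      (hE _ (Complex.exp_ne_zero v) (hre v h0 h1)).mul (by fun_prop)
    exact h2.comp v Complex.differentiable_exp.differentiableAt
  have key : ‖g (Complex.exp w)‖ ≤ K := by
    -- The exponential maps the strip of width `θ` onto the sector; order `2` is admissible because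
    -- `2 < π/θ`.
    refine PhragmenLindelof.horizontal_strip (f := fun v => g (Complex.exp v)) (a := 0) (b := θ)
      ?_ ⟨2, ?_, a + 2 * c, ?_⟩ ?_ ?_ hw0 hw
    · refine DifferentiableOn.diffContOnCl fun v hv => ?_
      have hv' : v ∈ Complex.im ⁻¹' Set.Icc 0 θ :=
        closure_minimal (Set.preimage_mono Set.Ioo_subset_Icc_self)
          (isClosed_Icc.preimage Complex.continuous_im) hv
      exact (hd v hv'.1 hv'.2).differentiableWithinAt
    · rw [sub_zero, lt_div_iff₀ hθ0]; linarith
    · refine Asymptotics.IsBigO.of_bound K ?_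
      refine Filter.eventually_of_mem (Filter.mem_inf_of_right (Filter.mem_principal_self _)) ?_
      intro v hv
      have h1 : ‖Complex.exp v‖ ^ 2 ≤ Real.exp (2 * |v.re|) := by
        rw [Complex.norm_exp, ← Real.exp_nat_mul]
        exact Real.exp_le_exp.mpr (by push_cast; linarith [le_abs_self v.re])
      have h2 := Complex.abs_re_le_norm (Complex.exp v)
      have hr0 := hre v hv.1.le hv.2.le
      have h4 : (Complex.exp v).re ^ 2 ≤ ‖Complex.exp v‖ ^ 2 := sq_le_sq' (by
        linarith [neg_abs_le (Complex.exp v).re]) ((le_abs_self _).trans h2)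
      have h5 : -((Complex.exp v).re * (Complex.exp v).im) ≤ ‖Complex.exp v‖ ^ 2 := by
        rw [← Complex.normSq_eq_norm_sq, Complex.normSq_apply]
        nlinarith [sq_nonneg ((Complex.exp v).re + (Complex.exp v).im),
          mul_self_nonneg (Complex.exp v).re, mul_self_nonneg (Complex.exp v).im]
      rw [hgn]
      calc _ ≤ K * Real.exp (a * (Complex.exp v).re ^ 2) *
            Real.exp (-(2 * c * ((Complex.exp v).re * (Complex.exp v).im))) := by
              gcongr; exact hb _ hr0
        _ = K * Real.exp (a * (Complex.exp v).re ^ 2 +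
            2 * c * -((Complex.exp v).re * (Complex.exp v).im)) := by
              rw [mul_assoc, ← Real.exp_add]; ring_nf
        _ ≤ K * Real.exp (a * Real.exp (2 * |v.re|) + 2 * c * Real.exp (2 * |v.re|)) := by
              gcongr
              · exact h4.trans h1
              · exact h5.trans h1
        _ = K * ‖Real.exp ((a + 2 * c) * Real.exp (2 * |v.re|))‖ := by
              rw [Real.norm_of_nonneg (Real.exp_pos _).le, add_mul]
    · intro v hv
      have hv' : Complex.exp v = ((Real.exp v.re : ℝ) : ℂ) := by
        rw [Complex.exp_eq_exp_re_mul_sin_add_cos, hv]; simp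
      rw [hgn, hv', Complex.ofReal_im]
      simpa using hr _ (Real.exp_pos v.re).le
    · intro v hv
      have hrv := hre v (by linarith) hv.le
      rw [hgn]
      calc _ ≤ K * Real.exp (a * (Complex.exp v).re ^ 2) *
            Real.exp (-(2 * c * ((Complex.exp v).re * (Complex.exp v).im))) := by
              gcongr; exact hb _ hrv
        _ = K := by
            rw [mul_assoc, ← Real.exp_add, Complex.exp_re, Complex.exp_im, hv, hc]
            have : a * (Real.exp v.re * Real.cos θ) ^ 2 + -(2 * (a * Real.cos θ / (2 * Real.sin θ))
              * (Real.exp v.re * Real.cos θ * (Real.exp v.re * Real.sin θ))) = 0 := by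
              field_simp; ring
            rw [this, Real.exp_zero, mul_one]
  rw [hgn] at key
  have h1 : ‖E (Complex.exp w)‖ ≤ K * Real.exp (2 * c *
      ((Complex.exp w).re * (Complex.exp w).im)) := by
    rw [Real.exp_neg, ← div_eq_mul_inv, div_le_iff₀ (Real.exp_pos _)] at key
    exact key
  refine h1.trans ?_
  have h2 : 2 * ((Complex.exp w).re * (Complex.exp w).im) ≤ ‖Complex.exp w‖ ^ 2 := by
    rw [← Complex.normSq_eq_norm_sq, Complex.normSq_apply]
    nlinarith [sq_nonneg ((Complex.exp w).re - (Complex.exp w).im)]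
  have h3 : 2 * c * ((Complex.exp w).re * (Complex.exp w).im) ≤ c * ‖Complex.exp w‖ ^ 2 := by
    nlinarith
  gcongr

/-- The critical case of Phragmén–Lindelöf in the first quadrant. -/
theorem norm_le_of_quadrant_of_gaussian_growth {E : ℂ → ℂ} {a K : ℝ} (ha : 0 ≤ a)
    (hE : ∀ z : ℂ, z ≠ 0 → 0 ≤ z.re → DifferentiableAt ℂ E z)
    (hb : ∀ z : ℂ, 0 ≤ z.re → ‖E z‖ ≤ K * Real.exp (a * z.re ^ 2))
    (hr : ∀ x : ℝ, 0 ≤ x → ‖E x‖ ≤ K) (z : ℂ) (hz : 0 ≤ z.re) (hz' : 0 ≤ z.im) : ‖E z‖ ≤ K := by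
  rcases hz.eq_or_lt with h0 | hpos
  · simpa [← h0] using hb z hz
  have hz0 : z ≠ 0 := by rintro rfl; simp at hpos
  have harg0 : 0 ≤ z.arg := Complex.arg_nonneg_iff.mpr hz'
  have harg : z.arg < Real.pi / 2 := by
    have := Complex.abs_arg_lt_pi_div_two_iff.mpr (Or.inl hpos)
    exact (le_abs_self _).trans_lt this
  -- Aperture `π/2` is critical for order two, so narrower sectors containing `z` are used. As `θ →
  -- π/2` the exponent, proportional to `cot θ`, tends to `0`.
  have hev : ∀ᶠ θ in nhdsWithin (Real.pi / 2) (Set.Iio (Real.pi / 2)),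
      ‖E z‖ ≤ K * Real.exp (a * Real.cos θ / (2 * Real.sin θ) * ‖z‖ ^ 2) := by
    filter_upwards [Ioo_mem_nhdsLT harg] with θ hθ
    have := norm_le_of_sector ha (harg0.trans_lt hθ.1) hθ.2 hE hb hr (Complex.log z)
      (by rwa [Complex.log_im]) (by rw [Complex.log_im]; exact hθ.1.le)
    rwa [Complex.exp_log hz0] at this
  refine ge_of_tendsto (f := fun θ => K * Real.exp (a * Real.cos θ / (2 * Real.sin θ) * ‖z‖ ^ 2))
    ?_ hev
  have hcont : ContinuousAt (fun θ => K * Real.exp (a * Real.cos θ / (2 * Real.sin θ) * ‖z‖ ^ 2))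
      (Real.pi / 2) := by
    have : 2 * Real.sin (Real.pi / 2) ≠ 0 := by simp
    fun_prop (disch := assumption)
  have := hcont.tendsto
  simp only [Real.cos_pi_div_two, mul_zero, zero_div, zero_mul, Real.exp_zero, mul_one] at this
  exact this.mono_left nhdsWithin_le_nhds

/-- Dividing by `(z + 1)^m` reduces to the bounded case: on the right half-plane `(1 + |z|)/2 ≤ |z +
1| ≤ 1 + |z|`, which accounts for the `2^m`. -/
theorem norm_le_mul_pow_of_quadrant {F : ℂ → ℂ} (hF : Differentiable ℂ F) {a K : ℝ} {m : ℕ}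
    (ha : 0 ≤ a) (hb : ∀ z : ℂ, ‖F z‖ ≤ K * (1 + ‖z‖) ^ m * Real.exp (a * z.re ^ 2))
    (hr : ∀ x : ℝ, ‖F x‖ ≤ K * (1 + |x|) ^ m) (z : ℂ) (hz : 0 ≤ z.re) (hz' : 0 ≤ z.im) :
    ‖F z‖ ≤ K * 2 ^ m * (1 + ‖z‖) ^ m := by
  have hK : 0 ≤ K := by simpa using (norm_nonneg _).trans (hr 0)
  have hlow (w : ℂ) (hw : 0 ≤ w.re) : 1 + ‖w‖ ≤ 2 * ‖w + 1‖ := by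
    have h1 : 1 ≤ ‖w + 1‖ := by
      have := (le_abs_self _).trans (Complex.abs_re_le_norm (w + 1))
      simp at this; linarith
    have h2 : ‖w‖ ≤ ‖w + 1‖ := by
      rw [← sq_le_sq₀ (norm_nonneg _) (norm_nonneg _), ← Complex.normSq_eq_norm_sq,
        ← Complex.normSq_eq_norm_sq, Complex.normSq_apply, Complex.normSq_apply]
      simp; nlinarith
    linarith
  have hpos (w : ℂ) (hw : 0 ≤ w.re) : 0 < ‖w + 1‖ := by
    have := hlow w hw; have := norm_nonneg w; linarith
  have hdiv (w : ℂ) (hw : 0 ≤ w.re) (B : ℝ) (hB : ‖F w‖ ≤ K * (1 + ‖w‖) ^ m * B) (hB0 : 0 ≤ B) :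
      ‖F w / (w + 1) ^ m‖ ≤ K * 2 ^ m * B := by
    rw [norm_div, norm_pow, div_le_iff₀ (pow_pos (hpos w hw) m)]
    calc ‖F w‖ ≤ K * (1 + ‖w‖) ^ m * B := hB
      _ ≤ K * (2 * ‖w + 1‖) ^ m * B := by gcongr; exact hlow w hw
      _ = _ := by rw [mul_pow]; ring
  have key := norm_le_of_quadrant_of_gaussian_growth (E := fun w => F w / (w + 1) ^ m)
    (K := K * 2 ^ m) ha (fun w _ hw => ?_) (fun w hw => hdiv w hw _ (hb w) (Real.exp_pos _).le)
    (fun x hx => ?_) z hz hz'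
  · rw [norm_div, norm_pow, div_le_iff₀ (pow_pos (hpos z hz) m)] at key
    refine key.trans ?_
    gcongr
    calc ‖z + 1‖ ≤ ‖z‖ + ‖(1 : ℂ)‖ := norm_add_le _ _
      _ = 1 + ‖z‖ := by rw [norm_one, add_comm]
  · exact hF.differentiableAt.div (by fun_prop)
      (pow_ne_zero _ (norm_pos_iff.mp (hpos w hw)))
  · have := hdiv x (by simpa using hx) 1 (by simpa using hr x) zero_le_one
    simpa using this

/-- The Phragmén–Lindelöf step in Hardy's uncertainty principle. -/
theorem norm_le_mul_pow_of_gaussian_growth {F : ℂ → ℂ} (hF : Differentiable ℂ F) {a K : ℝ} {m : ℕ}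
    (ha : 0 ≤ a) (hb : ∀ z : ℂ, ‖F z‖ ≤ K * (1 + ‖z‖) ^ m * Real.exp (a * z.re ^ 2))
    (hr : ∀ x : ℝ, ‖F x‖ ≤ K * (1 + |x|) ^ m) (z : ℂ) :
    ‖F z‖ ≤ K * 2 ^ m * (1 + ‖z‖) ^ m := by
  -- The bounds depend only on `|z|` and `(Re z)²`, so the other quadrants follow by conjugation and
  -- by `z ↦ -z`.
  have upper {F : ℂ → ℂ} (hF : Differentiable ℂ F)
      (hb : ∀ z : ℂ, ‖F z‖ ≤ K * (1 + ‖z‖) ^ m * Real.exp (a * z.re ^ 2))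
      (hr : ∀ x : ℝ, ‖F x‖ ≤ K * (1 + |x|) ^ m) (z : ℂ) (hz : 0 ≤ z.re) :
      ‖F z‖ ≤ K * 2 ^ m * (1 + ‖z‖) ^ m := by
    rcases le_total 0 z.im with hi | hi
    · exact norm_le_mul_pow_of_quadrant hF ha hb hr z hz hi
    · have := norm_le_mul_pow_of_quadrant
        (F := fun w => (starRingEnd ℂ) (F ((starRingEnd ℂ) w)))
        (fun w => by simpa [Function.comp_def] using (hF ((starRingEnd ℂ) w)).conj_conj) ha (fun w => by simpa using hb ((starRingEnd ℂ) w))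
        (fun x => by simpa using hr x) ((starRingEnd ℂ) z) (by simpa using hz) (by simpa using hi)
      simpa using this
  rcases le_total 0 z.re with hi | hi
  · exact upper hF hb hr z hi
  · have := upper (F := fun w => F (-w)) (hF.comp differentiable_neg)
      (fun w => by simpa using hb (-w)) (fun x => by simpa using hr (-x)) (-z) (by simpa using hi)
    simpa using this

/-- An entire function of polynomial growth is a polynomial. -/
theorem exists_polynomial_of_norm_le_mul_pow {F : ℂ → ℂ} (hF : Differentiable ℂ F) {K : ℝ} {m : ℕ}
    (hb : ∀ z : ℂ, ‖F z‖ ≤ K * (1 + ‖z‖) ^ m) : ∃ S : Polynomial ℂ, ∀ z, F z = S.eval z := by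
  have hK : 0 ≤ K := by simpa using (norm_nonneg _).trans (hb 0)
  -- Cauchy's estimate on `|z| = R`, using `1 + R ≤ 2R` and `R^m / R^n ≤ 1/R` for `R ≥ 1`, then `R →
  -- ∞`.
  have hz (n : ℕ) (hn : m < n) : iteratedDeriv n F 0 = 0 := by
    have hbound (R : ℝ) (hR : 1 ≤ R) :
        ‖iteratedDeriv n F 0‖ ≤ n.factorial * (K * 2 ^ m) * R⁻¹ := by
      have hR0 : 0 < R := by linarith
      refine (Complex.norm_iteratedDeriv_le_of_forall_mem_sphere_norm_le (C := K * (2 * R) ^ m)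
        n hR0 hF.diffContOnCl fun z hz => (hb z).trans ?_).trans ?_
      · have : ‖z‖ = R := by simpa using hz
        rw [this]; gcongr; linarith
      · rw [div_le_iff₀ (by positivity)]
        have : R ^ m ≤ R⁻¹ * R ^ n := by
          rw [← div_eq_inv_mul, le_div_iff₀ hR0, ← pow_succ]
          exact pow_le_pow_right₀ hR hn
        calc n.factorial * (K * (2 * R) ^ m) = n.factorial * (K * 2 ^ m) * R ^ m := by
              rw [mul_pow]; ring
          _ ≤ n.factorial * (K * 2 ^ m) * (R⁻¹ * R ^ n) := by gcongr
          _ = _ := by ring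
    rw [← norm_le_zero_iff]
    have hlim := tendsto_inv_atTop_zero (𝕜 := ℝ) |>.const_mul (n.factorial * (K * 2 ^ m))
    rw [mul_zero] at hlim
    exact ge_of_tendsto hlim ((Filter.eventually_ge_atTop 1).mono hbound)
  refine ⟨∑ k ∈ Finset.range (m + 1),
    Polynomial.C ((k.factorial : ℂ)⁻¹ * iteratedDeriv k F 0) * Polynomial.X ^ k, fun z => ?_⟩
  rw [← Complex.taylorSeries_eq_of_entire' 0 z hF, tsum_eq_sum (s := Finset.range (m + 1)),
    Polynomial.eval_finsetSum]
  · simp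
  · intro k hk
    rw [Finset.mem_range, not_lt] at hk
    rw [hz k (by omega)]; simp

/-! ### Real zeros and domination of polynomials on the line -/

open Polynomial in
theorem continuous_norm_eval_ofReal (P : ℂ[X]) : Continuous fun x : ℝ => ‖P.eval (x : ℂ)‖ :=
  (P.continuous.comp Complex.continuous_ofReal).norm

open Polynomial in
theorem forall_norm_eval_le_of_forall_ne {R : ℂ[X]} {B : ℝ → ℝ} (hB : Continuous B) {a : ℝ}
    (h : ∀ x : ℝ, x ≠ a → ‖R.eval (x : ℂ)‖ ≤ B x) (x : ℝ) :
    ‖R.eval (x : ℂ)‖ ≤ B x := by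
  have hd : Dense {x : ℝ | x ≠ a} := dense_compl_singleton a
  have hcl : IsClosed {x : ℝ | ‖R.eval (x : ℂ)‖ ≤ B x} :=
    isClosed_le (continuous_norm_eval_ofReal R) hB
  exact (hcl.closure_subset_iff.mpr h) (hd x)

-- A zero of `P` at `a` is one of `R`. Cancelling `x - a` keeps the inequality off `a`, hence at `a`
-- by continuity, and the argument repeats.
open Polynomial in
theorem X_sub_C_pow_dvd_of_norm_eval_le {a : ℝ} (k : ℕ) {P R : ℂ[X]}
    (h : ∀ x : ℝ, ‖R.eval (x : ℂ)‖ ≤ ‖P.eval (x : ℂ)‖) (hP : (X - C (a : ℂ)) ^ k ∣ P) :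
    (X - C (a : ℂ)) ^ k ∣ R := by
  induction k generalizing P R with
  | zero => simp
  | succ k ih =>
    obtain ⟨P', rfl⟩ := hP
    have hR : R.IsRoot (a : ℂ) := by
      have := h a
      simpa [pow_succ] using this
    obtain ⟨R', rfl⟩ := dvd_iff_isRoot.mpr hR
    rw [pow_succ']
    refine mul_dvd_mul_left _ (ih (P := (X - C (a : ℂ)) ^ k * P') ?_ (dvd_mul_right _ _))
    refine forall_norm_eval_le_of_forall_ne (continuous_norm_eval_ofReal _) (a := a) fun x hx => ?_
    have h1 := h x
    have hx' : 0 < ‖(x : ℂ) - a‖ := norm_pos_iff.mpr (sub_ne_zero.mpr (by exact_mod_cast hx))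
    rw [pow_succ', mul_assoc, eval_mul, eval_mul (p := X - C (a : ℂ)), norm_mul, norm_mul] at h1
    simp only [eval_sub, eval_X, eval_C] at h1
    exact le_of_mul_le_mul_left h1 hx'

open Polynomial in
/-- If all zeros of `P` are real and `0 ≤ R ≤ P` on the real line, then `R` is a multiple of `P`. -/
theorem eq_C_mul_of_nonneg_of_le {P R : ℂ[X]} (hP0 : P ≠ 0) (hP : numRealZeros P = P.natDegree)
    (h0 : ∀ x : ℝ, 0 ≤ R.eval (x : ℂ)) (h1 : ∀ x : ℝ, R.eval (x : ℂ) ≤ P.eval (x : ℂ)) :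
    ∃ t : ℝ, 0 ≤ t ∧ t ≤ 1 ∧ R = C (t : ℂ) * P := by
  classical
  have hn (x : ℝ) : ‖R.eval (x : ℂ)‖ ≤ ‖P.eval (x : ℂ)‖ := by
    have h2 : ‖R.eval (x : ℂ)‖ = (R.eval (x : ℂ)).re :=
      congrArg Complex.re (RCLike.norm_of_nonneg' (h0 x))
    have h3 : ‖P.eval (x : ℂ)‖ = (P.eval (x : ℂ)).re :=
      congrArg Complex.re (RCLike.norm_of_nonneg' ((h0 x).trans (h1 x)))
    rw [h2, h3]
    exact (Complex.le_def.mp (h1 x)).1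
  -- The count forces every root of `P` to be real, and at each one `|R| ≤ |P|` bounds the
  -- multiplicity in `R` from below.
  have hdvd : P ∣ R := by
    by_cases hR0 : R = 0
    · simp [hR0]
    have hreal : ∀ z ∈ P.roots, z.im = 0 := by
      have hcard : Multiset.card (P.roots.filter fun z => z.im = 0) = Multiset.card P.roots := by
        rw [IsAlgClosed.card_roots_eq_natDegree, ← hP, numRealZeros]
      have := Multiset.eq_of_le_of_card_le (Multiset.filter_le _ _) hcard.ge
      exact Multiset.filter_eq_self.mp this
    rw [IsAlgClosed.dvd_iff_roots_le_roots hP0 hR0, Multiset.le_iff_count]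
    intro z
    by_cases hz : z ∈ P.roots
    · have hz' : z = ((z.re : ℝ) : ℂ) := Complex.ext rfl (by simpa using hreal z hz)
      rw [hz', count_roots, count_roots, le_rootMultiplicity_iff hR0]
      exact X_sub_C_pow_dvd_of_norm_eval_le _ hn (pow_rootMultiplicity_dvd _ _)
    · rw [Multiset.count_eq_zero_of_notMem hz]; exact Nat.zero_le _
  obtain ⟨S, rfl⟩ := hdvd
  have hPinf : ∀ᶠ x : ℝ in Filter.atTop, P.eval (x : ℂ) ≠ 0 := by
    have hfin : {x : ℝ | P.eval (x : ℂ) = 0}.Finite :=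
      (P.roots.toFinset.finite_toSet.preimage Complex.ofReal_injective.injOn).subset
        fun x hx => by simpa [hP0] using hx
    exact (hfin.eventually_cofinite_notMem).filter_mono Filter.atTop_le_cofinite
  have hS1 : ∀ᶠ x : ℝ in Filter.atTop, ‖S.eval (x : ℂ)‖ ≤ 1 := by
    filter_upwards [hPinf] with x hx
    have := hn x
    rw [eval_mul, norm_mul] at this
    exact le_of_mul_le_mul_left (by simpa using this) (norm_pos_iff.mpr hx)
  -- The quotient has modulus at most `1` far out on the line, so it cannot be a nonconstant
  -- polynomial.
  have hSdeg : S.degree ≤ 0 := by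
    by_contra! hd
    have ht := S.tendsto_norm_atTop hd (l := Filter.atTop) (z := fun x : ℝ => (x : ℂ))
      (by simpa using Filter.tendsto_abs_atTop_atTop)
    obtain ⟨x, hx1, hx2⟩ := (hS1.and (ht.eventually_gt_atTop 1)).exists
    linarith
  rw [eq_C_of_degree_le_zero hSdeg] at h0 h1 ⊢
  generalize S.coeff 0 = s at h0 h1
  obtain ⟨x, hx⟩ := hPinf.exists
  have hp : 0 < P.eval (x : ℂ) := lt_of_le_of_ne ((h0 x).trans (h1 x)) hx.symm
  obtain ⟨p, hp0, hpe⟩ : ∃ p : ℝ, 0 < p ∧ P.eval (x : ℂ) = p :=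
    ⟨_, (Complex.pos_iff.mp hp).1, Complex.ext rfl (by simpa using (Complex.pos_iff.mp hp).2.symm)⟩
  have h2 := h0 x
  have h3 := h1 x
  rw [eval_mul, eval_C, hpe] at h2 h3
  have h4 := Complex.nonneg_iff.mp h2
  have h5 := (Complex.le_def.mp h3).1
  rw [Complex.re_ofReal_mul, Complex.im_ofReal_mul] at h4
  rw [Complex.re_ofReal_mul, Complex.ofReal_re] at h5
  refine ⟨s.re, nonneg_of_mul_nonneg_right h4.1 hp0, ?_, ?_⟩
  · exact le_of_mul_le_mul_left (by simpa using h5) hp0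
  · have him : s.im = 0 := by
      rcases mul_eq_zero.mp h4.2.symm with h | h
      · exact absurd h hp0.ne'
      · exact h
    have : s = ((s.re : ℝ) : ℂ) := Complex.ext rfl (by simpa using him)
    rw [← this, mul_comm]

open Polynomial in
/-- The real zeros of a polynomial that is nonnegative on the real line are at least double. -/
theorem X_sub_C_sq_dvd_of_nonneg {P : ℂ[X]} (h0 : ∀ x : ℝ, 0 ≤ P.eval (x : ℂ)) {a : ℝ}
    (ha : P.eval (a : ℂ) = 0) : (X - C (a : ℂ)) ^ 2 ∣ P := by
  obtain ⟨S, rfl⟩ := dvd_iff_isRoot.mpr ha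
  rw [pow_two]
  refine mul_dvd_mul_left _ (dvd_iff_isRoot.mpr ?_)
  -- Hence `S ≤ 0` to the left of `a` and `S ≥ 0` to the right, so `S(a) = 0`.
  have hval (x : ℝ) : 0 ≤ ((x - a : ℝ) : ℂ) * S.eval (x : ℂ) := by
    simpa using h0 x
  have hc : Continuous fun x : ℝ => S.eval (x : ℂ) := S.continuous.comp Complex.continuous_ofReal
  refine le_antisymm ?_ ?_
  · refine le_of_tendsto ((hc.tendsto a).mono_left (nhdsWithin_le_nhds (s := Set.Iio a))) ?_
    filter_upwards [self_mem_nhdsWithin] with x hx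
    have hx' : 0 < a - x := sub_pos.mpr hx
    have h := mul_nonneg (Complex.zero_le_real.mpr (inv_nonneg.mpr hx'.le)) (hval x)
    rw [← mul_assoc, ← Complex.ofReal_mul, ← neg_sub a x, mul_neg, inv_mul_cancel₀ hx'.ne'] at h
    simpa using h
  · refine ge_of_tendsto ((hc.tendsto a).mono_left (nhdsWithin_le_nhds (s := Set.Ioi a))) ?_
    filter_upwards [self_mem_nhdsWithin] with x hx
    have hx' : 0 < x - a := sub_pos.mpr hx
    have h := mul_nonneg (Complex.zero_le_real.mpr (inv_nonneg.mpr hx'.le)) (hval x)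
    rwa [← mul_assoc, ← Complex.ofReal_mul, inv_mul_cancel₀ hx'.ne', Complex.ofReal_one,
      one_mul] at h

open Polynomial in
theorem numRealZeros_le_of_dvd {D P : ℂ[X]} (hP : P ≠ 0) (h : D ∣ P) :
    numRealZeros D ≤ numRealZeros P :=
  Multiset.card_le_card (Multiset.filter_le_filter _ (roots.le_of_dvd hP h))

-- By evenness `-a` would also be a zero, and both would be double by nonnegativity: four real zeros
-- in all.
open Polynomial in
theorem eval_ofReal_ne_zero_of_numRealZeros_lt_four {P : ℂ[X]} (hP : P ≠ 0)
    (h0 : ∀ x : ℝ, 0 ≤ P.eval (x : ℂ)) (heven : ∀ x : ℝ, P.eval ((-x : ℝ) : ℂ) = P.eval (x : ℂ))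
    (hn : numRealZeros P < 4) {a : ℝ} (ha : a ≠ 0) : P.eval (a : ℂ) ≠ 0 := by
  intro hz
  have h1 := X_sub_C_sq_dvd_of_nonneg h0 hz
  have h2 := X_sub_C_sq_dvd_of_nonneg h0 ((heven a).trans hz)
  have hne : (a : ℂ) ≠ ((-a : ℝ) : ℂ) := by
    intro h
    have : a = -a := by exact_mod_cast h
    exact ha (by linarith)
  have h3 : (X - C (a : ℂ)) ^ 2 * (X - C ((-a : ℝ) : ℂ)) ^ 2 ∣ P :=
    ((isCoprime_X_sub_C_of_isUnit_sub (sub_ne_zero.mpr hne).isUnit).pow).mul_dvd h1 h2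
  have h4 : numRealZeros ((X - C (a : ℂ)) ^ 2 * (X - C ((-a : ℝ) : ℂ)) ^ 2) = 4 := by
    rw [numRealZeros, roots_mul (mul_ne_zero (pow_ne_zero _ (X_sub_C_ne_zero _))
      (pow_ne_zero _ (X_sub_C_ne_zero _))), roots_pow, roots_pow, roots_X_sub_C, roots_X_sub_C,
      Multiset.filter_eq_self.mpr]
    · simp
    · intro z hz
      simp only [Multiset.mem_add, Multiset.mem_nsmul, Multiset.mem_singleton] at hz
      rcases hz with ⟨-, rfl⟩ | ⟨-, rfl⟩ <;> exact Complex.ofReal_im _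
  have := numRealZeros_le_of_dvd hP h3
  omega

-- The degrees control the quotient near infinity; on the remaining compact set it is continuous
-- because `P` has no real zero.
open Polynomial in
theorem exists_norm_eval_le_mul {P R : ℂ[X]} (hP : ∀ x : ℝ, P.eval (x : ℂ) ≠ 0)
    (hdeg : R.degree ≤ P.degree) :
    ∃ K : ℝ, 0 < K ∧ ∀ x : ℝ, ‖R.eval (x : ℂ)‖ ≤ K * ‖P.eval (x : ℂ)‖ := by
  have hO := (isBigO_cobounded_of_degree_le hdeg).comp_tendsto
    (k := fun x : ℝ => (x : ℂ)) (l' := Bornology.cobounded ℝ)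
    (by rw [← tendsto_norm_atTop_iff_cobounded]; simpa only [Complex.norm_real] using tendsto_norm_cobounded_atTop (E := ℝ))
  obtain ⟨K₁, hK₁⟩ := hO.bound
  rw [Metric.cobounded_eq_cocompact, Filter.eventually_iff, Filter.mem_cocompact] at hK₁
  obtain ⟨s, hs, hsub⟩ := hK₁
  have hcont : Continuous fun x : ℝ => ‖R.eval (x : ℂ)‖ / ‖P.eval (x : ℂ)‖ :=
    (continuous_norm_eval_ofReal R).div (continuous_norm_eval_ofReal P)
      fun x => norm_ne_zero_iff.mpr (hP x)
  obtain ⟨K₂, hK₂⟩ := (hs.image hcont).bddAbove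
  refine ⟨max (max K₁ K₂) 1, by positivity, fun x => ?_⟩
  by_cases hx : x ∈ s
  · have := hK₂ ⟨x, hx, rfl⟩
    rw [div_le_iff₀ (norm_pos_iff.mpr (hP x))] at this
    refine this.trans ?_
    gcongr
    exact (le_max_right _ _).trans (le_max_left _ _)
  · have := hsub hx
    simp only [Set.mem_ofPred_eq, Function.comp_apply] at this
    refine this.trans ?_
    gcongr
    exact (le_max_left _ _).trans (le_max_left _ _)

open Polynomial in
/-- A polynomial of degree at least four that is even, nonnegative on the real line and has fewer
than four real zeros dominates `a x⁴ + b x²`. -/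
theorem exists_norm_eval_quartic_le {P : ℂ[X]} (hdeg : 4 ≤ P.natDegree)
    (h0 : ∀ x : ℝ, 0 ≤ P.eval (x : ℂ)) (heven : ∀ x : ℝ, P.eval ((-x : ℝ) : ℂ) = P.eval (x : ℂ))
    (hn : numRealZeros P < 4) (a b : ℂ) :
    ∃ K : ℝ, 0 < K ∧ ∀ x : ℝ, ‖a * x ^ 4 + b * x ^ 2‖ ≤ K * ‖P.eval (x : ℂ)‖ := by
  have hP : P ≠ 0 := by rintro rfl; simp at hdeg
  have hne {x : ℝ} (hx : x ≠ 0) := eval_ofReal_ne_zero_of_numRealZeros_lt_four hP h0 heven hn hx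
  -- If `P(0) = 0`, then `P = X²S` where `S` has no real zero, since a zero at `0` would give `X⁴ ∣
  -- P`; one compares `ax² + b` with `S`. Otherwise `P` has no real zero and the comparison is
  -- direct.
  by_cases hz : P.eval 0 = 0
  · obtain ⟨S, hS⟩ := X_sub_C_sq_dvd_of_nonneg h0 (a := 0) (by simpa using hz)
    simp only [Complex.ofReal_zero, C_0, sub_zero] at hS
    have hS0 : S ≠ 0 := by rintro rfl; simp at hS; exact hP hS
    have hSval (x : ℝ) : P.eval (x : ℂ) = (x : ℂ) ^ 2 * S.eval (x : ℂ) := by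
      rw [hS]; simp
    have hSpos (x : ℝ) (hx : x ≠ 0) : 0 ≤ S.eval (x : ℂ) := by
      have h := mul_nonneg (Complex.zero_le_real.mpr (inv_nonneg.mpr (sq_nonneg x))) (h0 x)
      rw [hSval, ← mul_assoc, ← Complex.ofReal_pow, ← Complex.ofReal_mul,
        inv_mul_cancel₀ (pow_ne_zero 2 hx), Complex.ofReal_one, one_mul] at h
      exact h
    have hc : Continuous fun x : ℝ => S.eval (x : ℂ) :=
      S.continuous.comp Complex.continuous_ofReal
    have hSpos' (x : ℝ) : 0 ≤ S.eval (x : ℂ) :=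
      closure_minimal (s := {x : ℝ | x ≠ 0}) hSpos (isClosed_Ici.preimage hc)
        (dense_compl_singleton 0 x)
    have hSne (x : ℝ) : S.eval (x : ℂ) ≠ 0 := by
      intro hx0
      by_cases hx : x = 0
      · have h2 := X_sub_C_sq_dvd_of_nonneg hSpos' hx0
        subst hx
        simp only [Complex.ofReal_zero, C_0, sub_zero] at h2
        have h4 : (X : ℂ[X]) ^ 4 ∣ P := by
          rw [hS]
          exact (by ring : (X : ℂ[X]) ^ 4 = X ^ 2 * X ^ 2) ▸ mul_dvd_mul_left _ h2
        have h5 : numRealZeros ((X : ℂ[X]) ^ 4) = 4 := by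
          rw [numRealZeros, roots_pow, roots_X, Multiset.filter_eq_self.mpr]
          · simp
          · intro z hz
            simp only [Multiset.mem_nsmul, Multiset.mem_singleton] at hz
            simp [hz.2]
        have := numRealZeros_le_of_dvd hP h4
        omega
      · exact hne hx (by rw [hSval, hx0, mul_zero])
    have hSdeg : 2 ≤ S.natDegree := by
      rw [hS, natDegree_mul (pow_ne_zero _ X_ne_zero) hS0, natDegree_X_pow] at hdeg
      omega
    obtain ⟨K, hK, hb⟩ := exists_norm_eval_le_mul (R := C a * X ^ 2 + C b) hSne (by
      rw [degree_eq_natDegree hS0]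
      refine le_trans (b := ((2 : ℕ) : WithBot ℕ)) ?_ (by exact_mod_cast hSdeg)
      compute_degree
      exact le_rfl)
    refine ⟨K, hK, fun x => ?_⟩
    have h1 := hb x
    simp only [eval_add, eval_mul, eval_C, eval_pow, eval_X] at h1
    calc ‖a * x ^ 4 + b * x ^ 2‖ = ‖(x : ℂ) ^ 2‖ * ‖a * x ^ 2 + b‖ := by
          rw [← norm_mul]; congr 1; ring
      _ ≤ ‖(x : ℂ) ^ 2‖ * (K * ‖S.eval (x : ℂ)‖) := by gcongr
      _ = _ := by rw [hSval, norm_mul]; ring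
  · obtain ⟨K, hK, hb⟩ := exists_norm_eval_le_mul (P := P) (R := C a * X ^ 4 + C b * X ^ 2)
      (fun x => by
        by_cases hx : x = 0
        · simpa [hx] using hz
        · exact hne hx) (by
      rw [degree_eq_natDegree hP]
      refine le_trans (b := ((4 : ℕ) : WithBot ℕ)) ?_ (by exact_mod_cast hdeg)
      compute_degree
      exact le_rfl)
    exact ⟨K, hK, fun x => by simpa using hb x⟩

/-! ### Hardy's uncertainty principle on the interval `I(f)` -/

theorem norm_cexp_two_pi_I_mul (x : ℝ) (z : ℂ) :
    ‖Complex.exp (2 * Complex.I * Real.pi * x * z)‖ = Real.exp (-(2 * Real.pi * x * z.im)) := by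
  rw [Complex.norm_exp]
  congr 1
  have : 2 * Complex.I * Real.pi * x * z = ((2 * Real.pi * x : ℝ) : ℂ) * (Complex.I * z) := by
    push_cast; ring
  rw [this, Complex.re_ofReal_mul]
  simp

theorem integrable_mul_gaussian {lam : ℝ} (hlam : 0 < lam) (P : Polynomial ℂ) :
    MeasureTheory.Integrable fun x : ℝ =>
      P.eval (x : ℂ) * (Real.exp (-(Real.pi * lam * x ^ 2)) : ℂ) := by
  simpa using integrable_eval_mul_gaussian hlam P 0

theorem fourierTransformPlus_mul_gaussian {lam : ℝ} (hlam : 0 < lam) (P : Polynomial ℂ) (ξ : ℝ) :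
    fourierTransformPlus
        (fun x : ℝ => P.eval (x : ℂ) * (Real.exp (-(Real.pi * lam * x ^ 2)) : ℂ)) ξ =
      (gaussianTransform lam P).eval (ξ : ℂ) * (Real.exp (-(Real.pi * ξ ^ 2 / lam)) : ℂ) := by
  rw [fourierTransformPlus, integral_eval_mul_gaussian hlam]
  push_cast
  rfl

theorem fourierTransformPlus_add {f g : ℝ → ℂ} (hf : MeasureTheory.Integrable f)
    (hg : MeasureTheory.Integrable g) (ξ : ℝ) :
    fourierTransformPlus (f + g) ξ = fourierTransformPlus f ξ + fourierTransformPlus g ξ := by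
  simp only [fourierTransformPlus, Pi.add_apply, add_mul]
  exact MeasureTheory.integral_add (integrable_mul_cexp_ofReal hf ξ)
    (integrable_mul_cexp_ofReal hg ξ)

theorem fourierTransformPlus_const_mul (f : ℝ → ℂ) (c : ℂ) (ξ : ℝ) :
    fourierTransformPlus (fun x => c * f x) ξ = c * fourierTransformPlus f ξ := by
  simp only [fourierTransformPlus, mul_assoc]
  exact MeasureTheory.integral_const_mul _ _

theorem norm_eval_le_mul_pow (Q : Polynomial ℂ) : ∃ K : ℝ, 0 ≤ K ∧
    ∀ z : ℂ, ∀ r : ℝ, ‖z‖ ≤ r → ‖Q.eval z‖ ≤ K * (1 + r) ^ Q.natDegree := by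
  refine ⟨∑ k ∈ Finset.range (Q.natDegree + 1), ‖Q.coeff k‖, by positivity, fun z r hr => ?_⟩
  have hr0 := (norm_nonneg z).trans hr
  rw [Polynomial.eval_eq_sum_range, Finset.sum_mul]
  refine norm_sum_le_of_le _ fun k hk => ?_
  rw [norm_mul, norm_pow]
  rw [Finset.mem_range] at hk
  gcongr
  calc ‖z‖ ^ k ≤ (1 + r) ^ k := by gcongr; linarith
    _ ≤ _ := pow_le_pow_right₀ (by linarith) (by omega)

open MeasureTheory in
theorem differentiable_fourierLaplace {lam : ℝ} (hlam : 0 < lam) (P : Polynomial ℂ) {g : ℝ → ℂ}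
    (hg : Continuous g)
    (hgP : ∀ x : ℝ, ‖g x‖ ≤ ‖P.eval (x : ℂ) * (Real.exp (-(Real.pi * lam * x ^ 2)) : ℂ)‖) :
    Differentiable ℂ fun z : ℂ =>
      ∫ x : ℝ, g x * Complex.exp (2 * Complex.I * Real.pi * x * z) := by
  intro z₀
  set M := |z₀.im| + 1 with hM
  have hdom (x : ℝ) (z : ℂ) (hz : |z.im| ≤ M) :
      -- On a horizontal strip the kernel is dominated by its moduli at `±iM`, one for each sign of
      -- `x`. This gives a bound uniform near `z₀` for differentiating under the integral.
      ‖Complex.exp (2 * Complex.I * Real.pi * x * z)‖ ≤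
        ‖Complex.exp (2 * Complex.I * Real.pi * x * (Complex.I * M))‖ +
        ‖Complex.exp (2 * Complex.I * Real.pi * x * (-(Complex.I * M)))‖ := by
    simp only [norm_cexp_two_pi_I_mul, Complex.neg_im, Complex.I_mul_im, Complex.ofReal_re]
    have h := abs_le.mp hz
    rcases le_total 0 x with hx | hx
    · refine le_add_of_nonneg_of_le (Real.exp_pos _).le (Real.exp_le_exp.mpr ?_)
      have : 0 ≤ 2 * Real.pi * x := by positivity
      nlinarith
    · refine le_add_of_le_of_nonneg (Real.exp_le_exp.mpr ?_) (Real.exp_pos _).le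
      have : 2 * Real.pi * x ≤ 0 := mul_nonpos_of_nonneg_of_nonpos (by positivity) hx
      nlinarith
  have hint (Q : Polynomial ℂ) := ((integrable_eval_mul_gaussian hlam Q (Complex.I * M)).norm).add
    ((integrable_eval_mul_gaussian hlam Q (-(Complex.I * M))).norm)
  refine (hasDerivAt_integral_of_dominated_loc_of_deriv_le (s := Metric.ball z₀ 1)
    (F' := fun z x => g x * (Complex.exp (2 * Complex.I * Real.pi * x * z) *
      (2 * Complex.I * Real.pi * x)))
    (Metric.ball_mem_nhds z₀ one_pos) (.of_forall fun z => ?_) ?_ ?_ (.of_forall fun x z hz => ?_)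
    ((hint (Polynomial.X * P)).const_mul (2 * Real.pi))
    (.of_forall fun x z _ => ?_)).2.differentiableAt
  · exact Continuous.aestronglyMeasurable (by fun_prop)
  · refine (hint P).mono' (Continuous.aestronglyMeasurable (by fun_prop)) (.of_forall fun x => ?_)
    simp only [Pi.add_apply, norm_mul] at hgP ⊢
    rw [← mul_add]
    exact mul_le_mul (hgP x) (hdom x z₀ (by linarith)) (norm_nonneg _) (by positivity)
  · exact Continuous.aestronglyMeasurable (by fun_prop)
  · have hz' : |z.im| ≤ M := by
      have h1 : |z.im - z₀.im| ≤ ‖z - z₀‖ := by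
        rw [← Complex.sub_im]; exact Complex.abs_im_le_norm _
      have h2 : ‖z - z₀‖ < 1 := by simpa [dist_eq_norm] using hz
      have h3 := abs_sub_abs_le_abs_sub z.im z₀.im
      linarith
    have h1 := mul_le_mul (hgP x) (hdom x z hz') (norm_nonneg _) (norm_nonneg _)
    have h2 := mul_le_mul_of_nonneg_right h1 (norm_nonneg (2 * Complex.I * Real.pi * x))
    have h3 : ‖2 * Complex.I * Real.pi * (x : ℂ)‖ = 2 * Real.pi * ‖(x : ℂ)‖ := by
      simp [abs_of_pos Real.pi_pos]
    rw [h3] at h2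
    simp only [Pi.add_apply, norm_mul, Polynomial.eval_mul, Polynomial.eval_X] at h2 h3 ⊢
    rw [h3]
    linarith
  · have := ((hasDerivAt_id z).const_mul (2 * Complex.I * Real.pi * (x : ℂ))).cexp.const_mul (g x)
    simpa using this

theorem eq_ofReal_re_of_nonneg {z : ℂ} (hz : 0 ≤ z) : z = (z.re : ℂ) :=
  Complex.ext rfl (by simpa using (Complex.nonneg_iff.mp hz).2.symm)

theorem norm_eq_re_of_nonneg {z : ℂ} (hz : 0 ≤ z) : ‖z‖ = z.re :=
  congrArg Complex.re (RCLike.norm_of_nonneg' hz)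

theorem norm_le_norm_of_nonneg_of_le {z w : ℂ} (hz : 0 ≤ z) (hzw : z ≤ w) : ‖z‖ ≤ ‖w‖ := by
  rw [norm_eq_re_of_nonneg hz, norm_eq_re_of_nonneg (hz.trans hzw)]
  exact (Complex.le_def.mp hzw).1

theorem coneInterval.nonneg_le {f g : ℝ → ℂ} (hg : g ∈ coneInterval f) (x : ℝ) :
    0 ≤ g x ∧ g x ≤ f x :=
  ⟨hg.1.2 x, by simpa using hg.2.2 x⟩

theorem coneInterval.integrable {f g : ℝ → ℂ} (hf : MeasureTheory.Integrable f)
    (hg : g ∈ coneInterval f) : MeasureTheory.Integrable g :=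
  hf.mono hg.1.1.1.aestronglyMeasurable (.of_forall fun x =>
    norm_le_norm_of_nonneg_of_le (coneInterval.nonneg_le hg x).1 (coneInterval.nonneg_le hg x).2)

theorem coneInterval.fourierTransformPlus_nonneg_le {f g : ℝ → ℂ}
    (hf : MeasureTheory.Integrable f) (hg : g ∈ coneInterval f) (ξ : ℝ) :
    0 ≤ fourierTransformPlus g ξ ∧ fourierTransformPlus g ξ ≤ fourierTransformPlus f ξ := by
  have hgi := coneInterval.integrable hf hg
  refine ⟨fourierTransformPlus_nonneg hg.1 hgi ξ, ?_⟩
  have h1 := fourierTransformPlus_nonneg hg.2 (hf.sub hgi) ξ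
  have h2 := fourierTransformPlus_add (hf.sub hgi) hgi ξ
  rw [sub_add_cancel] at h2
  rw [h2]
  exact le_add_of_nonneg_left h1

/-- Hardy's uncertainty principle for the interval generated by a Gaussian times a polynomial. -/
theorem exists_fourierTransformPlus_eq_of_mem_coneInterval {lam : ℝ} (hlam : 0 < lam)
    {P : Polynomial ℂ} {f g : ℝ → ℂ}
    (hf : f = fun x : ℝ => P.eval (x : ℂ) * (Real.exp (-(Real.pi * lam * x ^ 2)) : ℂ))
    (hg : g ∈ coneInterval f) :
    ∃ S : Polynomial ℂ, ∀ ξ : ℝ, fourierTransformPlus g ξ =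
      S.eval (ξ : ℂ) * (Real.exp (-(Real.pi * ξ ^ 2 / lam)) : ℂ) := by
  have hfi : MeasureTheory.Integrable f := hf ▸ integrable_mul_gaussian hlam P
  have hle (x : ℝ) : ‖g x‖ ≤ ‖f x‖ :=
    norm_le_norm_of_nonneg_of_le (coneInterval.nonneg_le hg x).1 (coneInterval.nonneg_le hg x).2
  have hf0 (x : ℝ) : 0 ≤ f x :=
    (coneInterval.nonneg_le hg x).1.trans (coneInterval.nonneg_le hg x).2
  set Q := gaussianTransform lam P with hQ
  obtain ⟨K, hK0, hK⟩ := norm_eval_le_mul_pow Q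
  set G : ℂ → ℂ := fun z => ∫ x : ℝ, g x * Complex.exp (2 * Complex.I * Real.pi * x * z) with hG
  have hGd : Differentiable ℂ G := differentiable_fourierLaplace hlam P hg.1.1.1
    (fun x => by simpa only [hf] using hle x)
  have hfz (z : ℂ) : ∫ x : ℝ, f x * Complex.exp (2 * Complex.I * Real.pi * x * z) =
      Q.eval z * Complex.exp (-(Real.pi * z ^ 2 / lam)) := by
    rw [hf]; exact integral_eval_mul_gaussian hlam P z
  -- As `|g| ≤ f`, the modulus of `G(x + iy)` is at most the integral of `f(t) exp(-2πty)`, the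
  -- transform of `f` at `iy`.
  have hGb (z : ℂ) : ‖G z‖ ≤
      ‖Q.eval (Complex.I * z.im)‖ * Real.exp (Real.pi * z.im ^ 2 / lam) := by
    have hreal (x : ℝ) : f x * Complex.exp (2 * Complex.I * Real.pi * x * (Complex.I * z.im)) =
        ((‖f x‖ * Real.exp (-(2 * Real.pi * x * z.im)) : ℝ) : ℂ) := by
      have : 2 * Complex.I * Real.pi * x * (Complex.I * z.im) =
          ((-(2 * Real.pi * x * z.im) : ℝ) : ℂ) := by
        push_cast; linear_combination (2 * Real.pi * x * z.im : ℂ) * Complex.I_mul_I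
      rw [this, norm_eq_re_of_nonneg (hf0 x), Complex.ofReal_mul, ← eq_ofReal_re_of_nonneg (hf0 x),
        Complex.ofReal_exp]
    have hint : MeasureTheory.Integrable fun x : ℝ =>
        ‖f x‖ * Real.exp (-(2 * Real.pi * x * z.im)) := by
      have := (integrable_eval_mul_gaussian hlam P z).norm
      simpa only [hf, norm_mul (_ * _) (Complex.exp _), norm_cexp_two_pi_I_mul] using this
    have h1 : ‖G z‖ ≤ ∫ x : ℝ, ‖f x‖ * Real.exp (-(2 * Real.pi * x * z.im)) := by
      refine MeasureTheory.norm_integral_le_of_norm_le hint (.of_forall fun x => ?_)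
      rw [norm_mul, norm_cexp_two_pi_I_mul]
      gcongr
      exact hle x
    have h2 : ((∫ x : ℝ, ‖f x‖ * Real.exp (-(2 * Real.pi * x * z.im)) : ℝ) : ℂ) =
        Q.eval (Complex.I * z.im) * Complex.exp (-(Real.pi * (Complex.I * z.im) ^ 2 / lam)) := by
      rw [← hfz, ← integral_complex_ofReal]
      exact MeasureTheory.integral_congr_ae (.of_forall fun x => (hreal x).symm)
    have h3 : -(Real.pi * (Complex.I * z.im) ^ 2 / lam) =
        ((Real.pi * z.im ^ 2 / lam : ℝ) : ℂ) := by
      rw [mul_pow, Complex.I_sq]; push_cast; ring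
    have h4 := congrArg norm h2
    rw [h3, norm_mul, Complex.norm_exp_ofReal, Complex.norm_real] at h4
    rw [← h4]
    exact h1.trans (le_abs_self _)
  have hGr (x : ℝ) : ‖G x‖ ≤ ‖Q.eval (x : ℂ)‖ * Real.exp (-(Real.pi * x ^ 2 / lam)) := by
    have h1 := coneInterval.fourierTransformPlus_nonneg_le hfi hg x
    have h2 := norm_le_norm_of_nonneg_of_le h1.1 h1.2
    rw [hf, fourierTransformPlus_mul_gaussian hlam, norm_mul, Complex.norm_real,
      Real.norm_of_nonneg (Real.exp_pos _).le] at h2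
    exact h2
  -- The factor has modulus `exp(π(x² - y²)/λ)`: it cancels the growth `exp(πy²/λ)` of `G`, and on
  -- the real axis its decay.
  set F : ℂ → ℂ := fun z => G z * Complex.exp (Real.pi * z ^ 2 / lam) with hF
  have hFd : Differentiable ℂ F := hGd.mul (by fun_prop)
  have hnexp (z : ℂ) : ‖Complex.exp (Real.pi * z ^ 2 / lam)‖ =
      Real.exp (Real.pi / lam * z.re ^ 2) * Real.exp (-(Real.pi * z.im ^ 2 / lam)) := by
    rw [Complex.norm_exp, ← Real.exp_add]
    congr 1
    have : Real.pi * z ^ 2 / lam = ((Real.pi / lam : ℝ) : ℂ) * z ^ 2 := by push_cast; ring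
    rw [this, Complex.re_ofReal_mul, pow_two, Complex.mul_re]
    ring
  have hFb := norm_le_mul_pow_of_gaussian_growth hFd (a := Real.pi / lam) (K := K)
    (m := Q.natDegree) (by positivity) (fun z => ?_) (fun x => ?_)
  · obtain ⟨S, hS⟩ := exists_polynomial_of_norm_le_mul_pow hFd hFb
    refine ⟨S, fun ξ => ?_⟩
    rw [← hS, hF, Complex.ofReal_exp, mul_assoc, ← Complex.exp_add]
    have : Real.pi * (ξ : ℂ) ^ 2 / lam + ((-(Real.pi * ξ ^ 2 / lam) : ℝ) : ℂ) = 0 := by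
      push_cast; ring
    rw [this, Complex.exp_zero, mul_one]
    rfl
  · rw [hF, norm_mul, hnexp]
    have h1 : ‖Complex.I * (z.im : ℂ)‖ ≤ ‖z‖ := by
      simpa using Complex.abs_im_le_norm z
    calc ‖G z‖ * (Real.exp (Real.pi / lam * z.re ^ 2) * Real.exp (-(Real.pi * z.im ^ 2 / lam)))
        ≤ (‖Q.eval (Complex.I * z.im)‖ * Real.exp (Real.pi * z.im ^ 2 / lam)) *
          (Real.exp (Real.pi / lam * z.re ^ 2) * Real.exp (-(Real.pi * z.im ^ 2 / lam))) := by
          gcongr; exact hGb z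
      _ = ‖Q.eval (Complex.I * z.im)‖ * Real.exp (Real.pi / lam * z.re ^ 2) *
          (Real.exp (Real.pi * z.im ^ 2 / lam) * Real.exp (-(Real.pi * z.im ^ 2 / lam))) := by
          ring
      _ = ‖Q.eval (Complex.I * z.im)‖ * Real.exp (Real.pi / lam * z.re ^ 2) := by
          rw [← Real.exp_add, add_neg_cancel, Real.exp_zero, mul_one]
      _ ≤ _ := by gcongr; exact hK _ _ h1
  · rw [hF, norm_mul, hnexp]
    calc ‖G x‖ * (Real.exp (Real.pi / lam * (x : ℂ).re ^ 2) *
          Real.exp (-(Real.pi * (x : ℂ).im ^ 2 / lam)))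
        ≤ (‖Q.eval (x : ℂ)‖ * Real.exp (-(Real.pi * x ^ 2 / lam))) *
          (Real.exp (Real.pi / lam * (x : ℂ).re ^ 2) *
          Real.exp (-(Real.pi * (x : ℂ).im ^ 2 / lam))) := by
          gcongr; exact hGr x
      _ = ‖Q.eval (x : ℂ)‖ := by
          rw [mul_assoc, ← Real.exp_add, ← Real.exp_add, Complex.ofReal_re, Complex.ofReal_im]
          have : -(Real.pi * x ^ 2 / lam) + (Real.pi / lam * x ^ 2 + -(Real.pi * 0 ^ 2 / lam)) = 0 := by
            ring
          rw [this, Real.exp_zero, mul_one]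
      _ ≤ _ := hK _ _ (by simp)

/-! ### Sufficiency: all zeros real on one side -/

theorem positivePositiveDefinite.const_mul {f : ℝ → ℂ} (hf : f ∈ positivePositiveDefinite) {t : ℝ}
    (ht : 0 ≤ t) : (fun x => (t : ℂ) * f x) ∈ positivePositiveDefinite := by
  have ht' : (0 : ℂ) ≤ t := Complex.zero_le_real.mpr ht
  refine ⟨⟨continuous_const.mul hf.1.1, fun n x c => ?_⟩, fun x => mul_nonneg ht' (hf.2 x)⟩
  refine (mul_nonneg ht' (hf.1.2 n x c)).trans_eq ?_
  simp only [Finset.mul_sum]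
  exact Finset.sum_congr rfl fun j _ => Finset.sum_congr rfl fun k _ => by ring

theorem const_mul_mem_coneInterval {f : ℝ → ℂ} (hf : f ∈ positivePositiveDefinite) {t : ℝ}
    (ht : 0 ≤ t) (ht' : t ≤ 1) : (fun x => (t : ℂ) * f x) ∈ coneInterval f := by
  refine ⟨positivePositiveDefinite.const_mul hf ht, ?_⟩
  have : (f - fun x => (t : ℂ) * f x) = fun x => ((1 - t : ℝ) : ℂ) * f x := by
    ext x; simp; ring
  rw [this]
  exact positivePositiveDefinite.const_mul hf (by linarith)

theorem isExtremalRayGenerator_of_subset {f : ℝ → ℂ} (hf : f ∈ positivePositiveDefinite)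
    (h : ∀ g ∈ coneInterval f, ∃ t : ℝ, 0 ≤ t ∧ t ≤ 1 ∧ g = fun x => (t : ℂ) * f x) :
    IsExtremalRayGenerator f := by
  refine Set.Subset.antisymm h ?_
  rintro g ⟨t, ht, ht', rfl⟩
  exact const_mul_mem_coneInterval hf ht ht'

theorem nonneg_and_le_of_mul_exp {p q : ℂ} {r : ℝ}
    (h : 0 ≤ p * (Real.exp r : ℂ) ∧ p * (Real.exp r : ℂ) ≤ q * (Real.exp r : ℂ)) :
    0 ≤ p ∧ p ≤ q := by
  have he : (0 : ℂ) < (Real.exp r : ℂ) := Complex.zero_lt_real.mpr (Real.exp_pos r)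
  exact ⟨le_of_mul_le_mul_right (by simpa using h.1) he, le_of_mul_le_mul_right h.2 he⟩

theorem integrable_mul_gaussian_div {lam : ℝ} (hlam : 0 < lam) (S : Polynomial ℂ) :
    MeasureTheory.Integrable fun ξ : ℝ =>
      S.eval (ξ : ℂ) * (Real.exp (-(Real.pi * ξ ^ 2 / lam)) : ℂ) := by
  have := integrable_mul_gaussian (inv_pos.mpr hlam) S
  refine this.congr (.of_forall fun ξ => ?_)
  simp only
  congr 4
  ring

theorem isExtremalRayGenerator_of_numRealZeros {lam : ℝ} (hlam : 0 < lam) {P : Polynomial ℂ}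
    (hP0 : P ≠ 0) {f : ℝ → ℂ}
    (hf : f = fun x : ℝ => P.eval (x : ℂ) * (Real.exp (-(Real.pi * lam * x ^ 2)) : ℂ))
    (hpos : f ∈ positivePositiveDefinite) (hz : numRealZeros P = P.natDegree) :
    IsExtremalRayGenerator f := by
  refine isExtremalRayGenerator_of_subset hpos fun g hg => ?_
  have hfi : MeasureTheory.Integrable f := hf ▸ integrable_mul_gaussian hlam P
  obtain ⟨S, hS⟩ := exists_fourierTransformPlus_eq_of_mem_coneInterval hlam hf hg
  have hgS : fourierTransformPlus g = fun ξ : ℝ =>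
      S.eval (ξ : ℂ) * (Real.exp (-(Real.pi * ξ ^ 2 / lam)) : ℂ) := funext hS
  have hgi' : MeasureTheory.Integrable (fourierTransformPlus g) :=
    hgS ▸ integrable_mul_gaussian_div hlam S
  -- Inversion applies the same transform, now with parameter `1/λ`, and evaluates it at `-x`.
  set R := (gaussianTransform lam⁻¹ S).comp (-Polynomial.X) with hR
  have hgR (x : ℝ) : g x = R.eval (x : ℂ) * (Real.exp (-(Real.pi * lam * x ^ 2)) : ℂ) := by
    rw [eq_integral_fourierTransformPlus hg.1.1.1 (coneInterval.integrable hfi hg) hgi', hR,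
      Polynomial.eval_comp]
    have h := integral_eval_mul_gaussian (inv_pos.mpr hlam) S ((-x : ℝ) : ℂ)
    have h2 : -(Real.pi * ((-x : ℝ) : ℂ) ^ 2 / ((lam⁻¹ : ℝ) : ℂ)) =
        ((-(Real.pi * lam * x ^ 2) : ℝ) : ℂ) := by
      push_cast; rw [div_inv_eq_mul]; ring
    rw [h2, ← Complex.ofReal_exp] at h
    simp only [Polynomial.eval_neg, Polynomial.eval_X]
    rw [← Complex.ofReal_neg, ← h]
    refine MeasureTheory.integral_congr_ae (.of_forall fun ξ => ?_)
    simp only [hS]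
    congr 4
    ring_nf
  have hle (x : ℝ) : 0 ≤ R.eval (x : ℂ) ∧ R.eval (x : ℂ) ≤ P.eval (x : ℂ) := by
    have := coneInterval.nonneg_le hg x
    rw [hgR] at this
    simp only [hf] at this
    exact nonneg_and_le_of_mul_exp this
  obtain ⟨t, ht, ht', hRt⟩ := eq_C_mul_of_nonneg_of_le hP0 hz (fun x => (hle x).1)
    fun x => (hle x).2
  refine ⟨t, ht, ht', funext fun x => ?_⟩
  rw [hgR, hRt, hf, Polynomial.eval_mul, Polynomial.eval_C, mul_assoc]

/-- The comparison is made between the transforms, where `0 ≤ ĝ ≤ f̂`; inversion carries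
proportionality back to `g` and `f`. -/
theorem isExtremalRayGenerator_of_numRealZeros_transform {lam : ℝ} (hlam : 0 < lam)
    {P : Polynomial ℂ} (hP0 : gaussianTransform lam P ≠ 0) {f : ℝ → ℂ}
    (hf : f = fun x : ℝ => P.eval (x : ℂ) * (Real.exp (-(Real.pi * lam * x ^ 2)) : ℂ))
    (hpos : f ∈ positivePositiveDefinite)
    (hz : numRealZeros (gaussianTransform lam P) = (gaussianTransform lam P).natDegree) :
    IsExtremalRayGenerator f := by
  refine isExtremalRayGenerator_of_subset hpos fun g hg => ?_
  have hfi : MeasureTheory.Integrable f := hf ▸ integrable_mul_gaussian hlam P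
  have hfQ : fourierTransformPlus f = fun ξ : ℝ => (gaussianTransform lam P).eval (ξ : ℂ) *
      (Real.exp (-(Real.pi * ξ ^ 2 / lam)) : ℂ) := by
    rw [hf]; exact funext fun ξ => fourierTransformPlus_mul_gaussian hlam P ξ
  obtain ⟨S, hS⟩ := exists_fourierTransformPlus_eq_of_mem_coneInterval hlam hf hg
  have hgi' : MeasureTheory.Integrable (fourierTransformPlus g) := by
    rw [funext hS]; exact integrable_mul_gaussian_div hlam S
  have hfi' : MeasureTheory.Integrable (fourierTransformPlus f) := by
    rw [hfQ]; exact integrable_mul_gaussian_div hlam _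
  have hle (ξ : ℝ) : 0 ≤ S.eval (ξ : ℂ) ∧ S.eval (ξ : ℂ) ≤
      (gaussianTransform lam P).eval (ξ : ℂ) := by
    have := coneInterval.fourierTransformPlus_nonneg_le hfi hg ξ
    rw [hS, hfQ] at this
    exact nonneg_and_le_of_mul_exp this
  obtain ⟨t, ht, ht', hSt⟩ := eq_C_mul_of_nonneg_of_le hP0 hz (fun x => (hle x).1)
    fun x => (hle x).2
  refine ⟨t, ht, ht', funext fun x => ?_⟩
  rw [eq_integral_fourierTransformPlus hg.1.1.1 (coneInterval.integrable hfi hg) hgi',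
    eq_integral_fourierTransformPlus hpos.1.1 hfi hfi', ← MeasureTheory.integral_const_mul]
  refine MeasureTheory.integral_congr_ae (.of_forall fun ξ => ?_)
  simp only [hS, hfQ, hSt, Polynomial.eval_mul, Polynomial.eval_C]
  ring

/-! ### Necessity: a perturbation inside the cone -/

theorem nonneg_add_ofReal {z : ℂ} (hz : 0 ≤ z) {r : ℝ} (hr : ‖(r : ℂ)‖ ≤ ‖z‖) : 0 ≤ z + r := by
  rw [norm_eq_re_of_nonneg hz, Complex.norm_real, Real.norm_eq_abs] at hr
  rw [eq_ofReal_re_of_nonneg hz, ← Complex.ofReal_add]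
  exact Complex.zero_le_real.mpr (by linarith [neg_abs_le r])

open Polynomial in
/-- The Gaussian transform of `x⁴ - 3 x² / (2 π lam)` has a double zero at the origin. -/
theorem eval_gaussianTransform_quartic {lam : ℝ} (hlam : 0 < lam) (ξ : ℂ) :
    (gaussianTransform lam
      (X ^ 4 + C ((-(3 / (2 * Real.pi * lam)) : ℝ) : ℂ) * X ^ 2)).eval ξ =
      (((Real.sqrt lam)⁻¹ / lam ^ 4 : ℝ) : ℂ) * ξ ^ 4 +
        ((-(3 * (Real.sqrt lam)⁻¹ / (2 * Real.pi * lam ^ 3)) : ℝ) : ℂ) * ξ ^ 2 := by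
  have hl : (lam : ℂ) ≠ 0 := by exact_mod_cast hlam.ne'
  have hp : (Real.pi : ℂ) ≠ 0 := by exact_mod_cast Real.pi_ne_zero
  have hs : (Real.sqrt lam : ℂ) ≠ 0 := by exact_mod_cast (Real.sqrt_pos.mpr hlam).ne'
  have hdeg : (X ^ 4 + C ((-(3 / (2 * Real.pi * lam)) : ℝ) : ℂ) * X ^ 2 : ℂ[X]).natDegree = 4 := by
    compute_degree!
  rw [gaussianTransform, hdeg]
  simp only [Finset.sum_range_succ, Finset.sum_range_zero, coeff_add, coeff_X_pow, coeff_C_mul,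
    gaussianMomentPoly, eval_add, eval_mul, eval_C, eval_X]
  norm_num
  field_simp
  simp only [Complex.I_sq]
  ring

theorem mem_positivePositiveDefinite_add {f γ : ℝ → ℂ} (hf : f ∈ positivePositiveDefinite)
    (hfi : MeasureTheory.Integrable f) (hfi' : MeasureTheory.Integrable (fourierTransformPlus f))
    (hγ : Continuous γ) (hγi : MeasureTheory.Integrable γ)
    (hγi' : MeasureTheory.Integrable (fourierTransformPlus γ))
    (h : ∀ x, 0 ≤ f x + γ x)
    (h' : ∀ ξ, 0 ≤ fourierTransformPlus f ξ + fourierTransformPlus γ ξ) :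
    f + γ ∈ positivePositiveDefinite := by
  have hF : fourierTransformPlus (f + γ) = fourierTransformPlus f + fourierTransformPlus γ :=
    funext (fourierTransformPlus_add hfi hγi)
  refine ⟨isPositiveDefiniteFun_of_fourierTransformPlus_nonneg (hf.1.1.add hγ) (hfi.add hγi)
    ?_ fun ξ => ?_, h⟩
  · rw [hF]; exact hfi'.add hγi'
  · rw [hF]; exact h' ξ

/-- The halves of `f + γ` and `f - γ` add up to `f`, so the first lies in `I(f)` and is a multiple
of `f`. -/
theorem exists_mul_eq_of_isExtremalRayGenerator {f γ : ℝ → ℂ} (hf : IsExtremalRayGenerator f)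
    (h₁ : f + γ ∈ positivePositiveDefinite) (h₂ : f - γ ∈ positivePositiveDefinite) :
    ∃ t : ℝ, γ = fun x => (t : ℂ) * f x := by
  have hmem : (fun x => ((1 / 2 : ℝ) : ℂ) * (f + γ) x) ∈ coneInterval f := by
    refine ⟨positivePositiveDefinite.const_mul h₁ (by norm_num), ?_⟩
    have : (f - fun x => ((1 / 2 : ℝ) : ℂ) * (f + γ) x) =
        fun x => ((1 / 2 : ℝ) : ℂ) * (f - γ) x := by
      ext x; simp; ring
    rw [this]
    exact positivePositiveDefinite.const_mul h₂ (by norm_num)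
  rw [hf] at hmem
  obtain ⟨t, -, -, ht⟩ := hmem
  refine ⟨2 * t - 1, funext fun x => ?_⟩
  have := congrFun ht x
  simp at this
  push_cast
  linear_combination 2 * this

open Polynomial in
theorem not_isExtremalRayGenerator {lam : ℝ} (hlam : 0 < lam) {P : ℂ[X]}
    (hdeg : 4 ≤ P.natDegree) {f : ℝ → ℂ}
    (hf : f = fun x : ℝ => P.eval (x : ℂ) * (Real.exp (-(Real.pi * lam * x ^ 2)) : ℂ))
    (hpos : f ∈ positivePositiveDefinite) (hP : numRealZeros P < 4)
    (hQ : numRealZeros (gaussianTransform lam P) < 4) : ¬ IsExtremalRayGenerator f := by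
  intro hext
  set Q := gaussianTransform lam P with hQdef
  have hfi : MeasureTheory.Integrable f := hf ▸ integrable_mul_gaussian hlam P
  have hfx (x : ℝ) : f x = P.eval (x : ℂ) * (Real.exp (-(Real.pi * lam * x ^ 2)) : ℂ) := by rw [hf]
  have hfQ (ξ : ℝ) : fourierTransformPlus f ξ =
      Q.eval (ξ : ℂ) * (Real.exp (-(Real.pi * ξ ^ 2 / lam)) : ℂ) := by
    rw [hf]; exact fourierTransformPlus_mul_gaussian hlam P ξ
  have hfi' : MeasureTheory.Integrable (fourierTransformPlus f) := by
    rw [funext hfQ]; exact integrable_mul_gaussian_div hlam _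
  have hfe (x : ℝ) : f (-x) = f x := positivePositiveDefinite.even hpos x
  have hfQ0 (ξ : ℝ) := fourierTransformPlus_nonneg hpos hfi ξ
  have hfQe (ξ : ℝ) : fourierTransformPlus f (-ξ) = fourierTransformPlus f ξ := by
    rw [fourierTransformPlus, ← MeasureTheory.integral_neg_eq_self, fourierTransformPlus]
    simp [hfe]
  have hexp (r : ℝ) : (0 : ℂ) < (Real.exp r : ℂ) := Complex.zero_lt_real.mpr (Real.exp_pos r)
  have hP0 (x : ℝ) : 0 ≤ P.eval (x : ℂ) := by
    have := hpos.2 x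
    rw [hfx] at this
    exact (nonneg_and_le_of_mul_exp ⟨this, le_rfl⟩).1
  have hQ0 (x : ℝ) : 0 ≤ Q.eval (x : ℂ) := by
    have := hfQ0 x
    rw [hfQ] at this
    exact (nonneg_and_le_of_mul_exp ⟨this, le_rfl⟩).1
  have hPe (x : ℝ) : P.eval ((-x : ℝ) : ℂ) = P.eval (x : ℂ) := by
    have := hfe x
    rw [hfx, hfx, neg_sq] at this
    exact mul_right_cancel₀ (hexp _).ne' this
  have hQe (x : ℝ) : Q.eval ((-x : ℝ) : ℂ) = Q.eval (x : ℂ) := by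
    have := hfQe x
    rw [hfQ, hfQ, neg_sq] at this
    exact mul_right_cancel₀ (hexp _).ne' this
  -- This is the ratio of the fourth to the second moment of `exp(-πλx²)`. The perturbation thus has
  -- integral zero, so its transform has no constant term.
  set κ : ℝ := 3 / (2 * Real.pi * lam) with hκ
  have hκ0 : 0 < κ := by positivity
  set R : ℂ[X] := X ^ 4 + C ((-κ : ℝ) : ℂ) * X ^ 2 with hR
  set α : ℝ := (Real.sqrt lam)⁻¹ / lam ^ 4
  set β : ℝ := -(3 * (Real.sqrt lam)⁻¹ / (2 * Real.pi * lam ^ 3))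
  have hTR (ξ : ℂ) : (gaussianTransform lam R).eval ξ = α * ξ ^ 4 + β * ξ ^ 2 :=
    eval_gaussianTransform_quartic hlam ξ
  have hRx (x : ℝ) : R.eval (x : ℂ) = ((x ^ 4 - κ * x ^ 2 : ℝ) : ℂ) := by
    simp [hR]; ring
  obtain ⟨K₁, hK₁, hb₁⟩ := exists_norm_eval_quartic_le hdeg hP0 hPe hP 1 ((-κ : ℝ) : ℂ)
  obtain ⟨K₂, hK₂, hb₂⟩ := exists_norm_eval_quartic_le
    (by rwa [hQdef, natDegree_gaussianTransform hlam]) hQ0 hQe hQ α β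
  set γ : ℝ → ℂ := fun x => R.eval (x : ℂ) * (Real.exp (-(Real.pi * lam * x ^ 2)) : ℂ) with hγ
  have hγc : Continuous γ :=
    (R.continuous.comp Complex.continuous_ofReal).mul (by fun_prop)
  have hγi : MeasureTheory.Integrable γ := integrable_mul_gaussian hlam R
  have hγQ (ξ : ℝ) : fourierTransformPlus γ ξ = ((α * ξ ^ 4 + β * ξ ^ 2 : ℝ) : ℂ) *
      (Real.exp (-(Real.pi * ξ ^ 2 / lam)) : ℂ) := by
    rw [hγ, fourierTransformPlus_mul_gaussian hlam, hTR]; push_cast; rfl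
  have hγi' : MeasureTheory.Integrable (fourierTransformPlus γ) := by
    have : fourierTransformPlus γ = fun ξ : ℝ => (gaussianTransform lam R).eval (ξ : ℂ) *
        (Real.exp (-(Real.pi * ξ ^ 2 / lam)) : ℂ) :=
      funext fun ξ => fourierTransformPlus_mul_gaussian hlam R ξ
    rw [this]; exact integrable_mul_gaussian_div hlam _
  -- This size is below both `1/K₁` and `1/K₂`, so the perturbation is dominated by `f` and its
  -- transform by that of `f`.
  have hmem (δ : ℝ) (hδ : |δ| = (K₁ + K₂)⁻¹) :
      (f + fun x => (δ : ℂ) * γ x) ∈ positivePositiveDefinite := by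
    have hFδ (ξ : ℝ) : fourierTransformPlus (fun x => (δ : ℂ) * γ x) ξ =
        δ * fourierTransformPlus γ ξ := fourierTransformPlus_const_mul γ δ ξ
    have hsmall {K : ℝ} (hK : K ≤ K₁ + K₂) {z : ℂ} {r : ℝ} (hr : ‖(r : ℂ)‖ ≤ K * ‖z‖) (e : ℝ) :
        ‖((δ * (r * Real.exp e) : ℝ) : ℂ)‖ ≤ ‖z * (Real.exp e : ℂ)‖ := by
      rw [Complex.ofReal_mul, Complex.ofReal_mul, norm_mul, norm_mul, norm_mul z, ← mul_assoc]
      gcongr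
      rw [Complex.norm_real, Real.norm_eq_abs, hδ, inv_mul_le_iff₀ (by positivity)]
      exact hr.trans (by gcongr)
    refine mem_positivePositiveDefinite_add hpos hfi hfi' (continuous_const.mul hγc)
      (hγi.const_mul _) ?_ (fun x => ?_) fun ξ => ?_
    · rw [funext hFδ]; exact hγi'.const_mul _
    · have h1 := hsmall (by linarith : K₁ ≤ K₁ + K₂) (z := P.eval (x : ℂ))
        (r := x ^ 4 - κ * x ^ 2) (by
          refine le_of_eq_of_le (congrArg norm ?_) (hb₁ x)
          push_cast; ring) (-(Real.pi * lam * x ^ 2))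
      rw [← hfx] at h1
      have h2 := nonneg_add_ofReal (hpos.2 x) h1
      rw [Complex.ofReal_mul, Complex.ofReal_mul, ← hRx] at h2
      exact h2
    · have h1 := hsmall (by linarith : K₂ ≤ K₁ + K₂) (z := Q.eval (ξ : ℂ))
        (r := α * ξ ^ 4 + β * ξ ^ 2) (by
          refine le_of_eq_of_le (congrArg norm ?_) (hb₂ ξ)
          push_cast; ring) (-(Real.pi * ξ ^ 2 / lam))
      rw [← hfQ] at h1
      have h2 := nonneg_add_ofReal (hfQ0 ξ) h1
      rw [Complex.ofReal_mul, Complex.ofReal_mul, ← hγQ] at h2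
      rw [hFδ]
      exact h2
  set ε : ℝ := (K₁ + K₂)⁻¹ with hε
  have hε0 : 0 < ε := by positivity
  have hm := hmem (-ε) (by rw [abs_neg, abs_of_pos hε0])
  obtain ⟨t, ht⟩ := exists_mul_eq_of_isExtremalRayGenerator hext
    (hmem ε (abs_of_pos hε0)) (by
      convert hm using 1
      ext x; simp [sub_eq_add_neg])
  have hsign (x : ℝ) : ε * ((x ^ 4 - κ * x ^ 2) * Real.exp (-(Real.pi * lam * x ^ 2))) =
      t * (f x).re := by
    have h1 := congrFun ht x
    simp only [hγ, hRx] at h1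
    rw [eq_ofReal_re_of_nonneg (hpos.2 x)] at h1
    exact_mod_cast h1
  have hre (x : ℝ) : 0 ≤ (f x).re := (Complex.nonneg_iff.mp (hpos.2 x)).1
  -- The factor `x⁴ - κx²` changes sign at `x² = κ`, and these two points lie on either side,
  -- whereas `t · f` keeps one sign.
  have hs1 := hsign (Real.sqrt (2 * κ))
  have hs2 := hsign (Real.sqrt (κ / 2))
  have e4 (x : ℝ) : x ^ 4 = (x ^ 2) ^ 2 := by ring
  rw [e4, Real.sq_sqrt (by positivity)] at hs1 hs2
  have ht1 : 0 < t * (f (Real.sqrt (2 * κ))).re := by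
    rw [← hs1]
    have : 0 < (2 * κ) ^ 2 - κ * (2 * κ) := by nlinarith
    positivity
  have ht2 : t * (f (Real.sqrt (κ / 2))).re < 0 := by
    rw [← hs2]
    have : (κ / 2) ^ 2 - κ * (κ / 2) < 0 := by nlinarith
    exact mul_neg_of_pos_of_neg hε0 (mul_neg_of_neg_of_pos this (Real.exp_pos _))
  have ht0 : 0 < t := pos_of_mul_pos_left ht1 (hre _)
  exact ht2.not_ge (mul_nonneg ht0.le (hre _))

theorem mainTheorem6 (lam : ℝ) (hlam : 0 < lam) (N : ℕ) (hN : 1 ≤ N)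
    (P : Polynomial ℂ) (hP : P.natDegree = 4 * N) (f : ℝ → ℂ)
    (hf : ∀ x : ℝ, f x = P.eval (x : ℂ) * (Real.exp (-(Real.pi * lam * x ^ 2)) : ℂ))
    (hpos : f ∈ positivePositiveDefinite) :
    ∃ Q : Polynomial ℂ,
      (∀ ξ : ℝ, fourierTransformPlus f ξ =
        Q.eval (ξ : ℂ) * (Real.exp (-(Real.pi * ξ ^ 2 / lam)) : ℂ)) ∧
      (IsExtremalRayGenerator f → 4 ≤ numRealZeros P ∨ 4 ≤ numRealZeros Q) ∧
      (numRealZeros P = 4 * N ∨ numRealZeros Q = 4 * N → IsExtremalRayGenerator f) := by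
  have hf' := funext hf
  have hQdeg : (gaussianTransform lam P).natDegree = 4 * N := by
    rw [natDegree_gaussianTransform hlam, hP]
  refine ⟨gaussianTransform lam P, fun ξ => ?_, fun hext => ?_, ?_⟩
  · rw [hf']; exact fourierTransformPlus_mul_gaussian hlam P ξ
  · by_contra! h
    exact not_isExtremalRayGenerator hlam (by omega) hf' hpos h.1 h.2 hext
  · rintro (h | h)
    · refine isExtremalRayGenerator_of_numRealZeros hlam ?_ hf' hpos (h.trans hP.symm)
      rintro rfl
      simp at hP; omega
    · refine isExtremalRayGenerator_of_numRealZeros_transform hlam ?_ hf' hpos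
        (h.trans hQdeg.symm)
      intro h0
      rw [h0] at hQdeg
      simp at hQdeg; omega
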